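/- **Problem.** Let $K\ge 1$, $\mathcal K=\{1,\dots,K\}$, channels $h_k\in\mathbb C^M\setminus\{0\}$ $(k\in\mathcal K)$, weights $u_k\ge 0$ not all zero, minimum rates $R_k^{th}\in\mathbb R$, power budget $P\ge0$, $\mu\ge0$, $P_c>0$; $\log$ is to base $2$. Write $\|p\|^2=\|p_c\|^2+\sum_k\|p_k\|^2$, $I_k=\sum_{j\in\mathcal K}|h_k^Hp_j|^2+1$, $J_k=\sum_{j\ne k}|h_k^Hp_j|^2+1$. The problem (srmax) is to maximize $$f=\frac{\sum_k u_k\,(C_k+\log(1+\gamma_{p,k}))}{\mu\|p\|^2+P_c}$$ over $p_c,p_1,\dots,p_K\in\mathbb C^M$, $\mathbf c=(C_k)$, $\gamma_p\ge0$, $s\ge0$, $d_k\in\mathbb R$, $e_k\in\mathbb C$ $(k>1)$ subject to (a) $\sqrt{\gamma_{p,k}}\sqrt{J_k}\le h_k^Hp_k$ for all $k$; $\sqrt s\sqrt{I_1}\le h_1^Hp_c$; $\sqrt s\sqrt{I_k}\le d_k$ and $d_k\le|e_k|$ for all $k>1$; (b) $h_k^Hp_k$ $(k\in\mathcal K)$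 and $h_1^Hp_c$ are real and nonnegative; $d_k\ge0$, $e_k=h_k^Hp_c$ for $k>1$; $\|p\|^2\le P$; (c) $\sum_kC_k\le\log(1+s)$ and $C_k\ge\max\{0,R_k^{th}-\log(1+\gamma_{p,k})\}$ for all $k$. For $\varepsilon,\eta>0$, a point is *$\varepsilon$-essential feasible* if it satisfies (b), (c) and each inequality $l\le r$ of (a) in the form $l\le r-\varepsilon$. A feasible point is *(essential) $(\varepsilon,\eta)$-optimal* if its objective value plus $\eta$ is at least the objective value of every $\varepsilon$-essential feasible point. The problem is *$\varepsilon$-essential infeasible* if it has no $\varepsilon$-essential feasible point. **Algorithm.** Boxes $\mathcal M=[\underline\gamma_p,\overline\gamma_p]\times[\underline s,\overline s]\times[\underline\alpha,\overline\alpha]$ (with $\alpha_k$ for $k>1$) may be empty. "$\angle e=\alpha$" means $e=|e|e^{i\alpha}$. For beamformers $p$ put $\gamma_{p,k}(p)=|h_k^Hp_k|^2/J_k$ and $s(p)=\min_k|h_k^Hp_c|^2/I_k$. *0. Initialization.* $\mathscr R$ consists of the box $\prod_k[0,P\|h_k\|^2]\times[0,\min_kP\|h_k\|^2]\times[0,2\pi]^{K-1}$.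 Either no incumbent is set and $\delta=0$; or beamformers $p$ with $\|p\|^2\le P$ and the phases of (b) are given for which some $\mathbf c$ satisfies (c) with $\gamma_p=\gamma_p(p)$, $s=s(p)$, the incumbent consists of $p,\gamma_p(p),s(p)$ and such a $\mathbf c$ of largest objective value $f$ (with $e_k=h_k^Hp_c$, $d_k=|e_k|$), and $\delta=f+\eta$. *1. Branching.* Choose a box of $\mathscr R$ with least stored bound $\beta$ and bisect it at the midpoint of a longest edge. *2. Reduction.* With the current $\delta$, replace each half $\mathcal M$ by $\mathcal M'$, as follows. Let $I$ be the set of $k$ with $R_k^{th}-\log(1+\overline\gamma_{p,k})>0$, $V=\sum_{k\in I}(R_k^{th}-\log(1+\overline\gamma_{p,k}))-\log(1+\overline s)$, $u_{\max}=\max_ku_k$, $U=u_{\max}\log(1+\overline s)+\sum_ku_k\log(1+\overline\gamma_{p,k})$, and $W=\mu(\underline s\max_k\|h_k\|^{-2}+\sum_k\underline\gamma_{p,k}\|h_k\|^{-2})+P_c$. Then $\underline\gamma_{p,k}'=\max\{\underline\gamma_{p,k},2^{\max\{(W\delta-U)/u_k,V\}}(1+\overline\gamma_{p,k})-1\}$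 for $k\in I$, $\underline\gamma_{p,k}'=\max\{\underline\gamma_{p,k},\max\{2^{(W\delta-U)/u_k}(1+\overline\gamma_{p,k}),2^{V+R_k^{th}}\}-1\}$ for $k\notin I$ (the terms with $u_k$ are left out if $u_k=0$), and $\underline s'=\max\{\underline s,2^{\max\{(W\delta-U)/u_{\max},V\}}(1+\overline s)-1\}$. If $\delta\mu>0$, then with $W'$ the value of $W$ at $(\underline\gamma_p',\underline s')$, $\overline\gamma_{p,k}'=\min\{\overline\gamma_{p,k},\underline\gamma_{p,k}'+(\delta\mu)^{-1}\|h_k\|^2(U-\delta W')\}$ and $\overline s'=\min\{\overline s,\underline s'+(\delta\mu)^{-1}\min_k\|h_k\|^2(U-\delta W')\}$. All other bounds are unchanged. *3. Bounding.* For each reduced box, $\beta(\mathcal M)$ is the minimum of $t$ over $p,\mathbf c,\rho,\sigma,d,e,t$ subject to (b), $\sum_ku_k(C_k+\rho_k)\ge\delta(\mu\|p\|^2+P_c)$, $\sum_kC_k\le\sigma$, $C_k\ge\max\{0,R_k^{th}-\rho_k\}$, $\log(1+\underline s)\le\sigma\le\log(1+\overline s)$, $\log(1+\underline\gamma_{p,k})\le\rho_k\le\log(1+\overline\gamma_{p,k})$,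 $\sqrt{\underline\gamma_{p,k}}\sqrt{J_k}\le t+h_k^Hp_k$ for all $k$, $\sqrt{\underline s}\sqrt{I_1}\le t+h_1^Hp_c$, and, for $k>1$, $\sqrt{\underline s}\sqrt{I_k}\le t+d_k$ and, if $\overline\alpha_k-\underline\alpha_k\le\pi$, the argument cut $$\sin\underline\alpha_k\,\Re e_k-\cos\underline\alpha_k\,\Im e_k\le0\le\sin\overline\alpha_k\,\Re e_k-\cos\overline\alpha_k\,\Im e_k,\qquad a_k\Re e_k+b_k\Im e_k\ge(d_k-t)(a_k^2+b_k^2)$$ with $a_k=\frac12(\cos\underline\alpha_k+\cos\overline\alpha_k)$, $b_k=\frac12(\sin\underline\alpha_k+\sin\overline\alpha_k)$; $\beta(\mathcal M)=\infty$ if this is infeasible or $\mathcal M=\emptyset$. *4. Feasible point.* If $\beta(\mathcal M)\le0$, take an optimal solution of the bounding problem and put $\gamma_{p,k}=2^{\rho_k}-1$, $s=2^\sigma-1$ and choose $\alpha_k$ $(k>1)$ by one of two rules, fixed in advance: *argument rule*: $\alpha_k\in[\underline\alpha_k,\overline\alpha_k]$ with $\angle e_k=\alpha_k$; *end point rule*: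 $\alpha_k\in\{\underline\alpha_k,\overline\alpha_k\}$ closest to an argument of $e_k$ in $[0,2\pi]$. For these fixed $(\gamma_p,s,\alpha)$ minimize $t$ over $p,\mathbf c,d,e,t$ subject to (b), (c), $f\ge\delta$, $\sqrt{\gamma_{p,k}}\sqrt{J_k}\le t+h_k^Hp_k$ for all $k$, $\sqrt s\sqrt{I_1}\le t+h_1^Hp_c$, and, for $k>1$, $\sqrt s\sqrt{I_k}\le t+d_k$, $d_k-t\le|e_k|$, $\angle e_k=\alpha_k$. If the minimum is at most $0$, take the beamformers $p$ of an optimal solution, and let the candidate of $\mathcal M$ consist of $p$, $\gamma_p(p)$, $s(p)$, $e_k=h_k^Hp_c$, $d_k=|e_k|$ and a $\mathbf c$ that maximizes $\sum_ku_kC_k$ subject to (c) and $f\ge\delta$; its value is its objective value. In all other cases $\mathcal M$ has no candidate and value $-\infty$. *5. Incumbent.* If the larger of the two values exceeds $\delta-\eta$, a candidate with that value becomes the incumbent and $\delta$ becomes that value plus $\eta$. *6. Pruning.* In $\mathscr R$, replace the bisected box by those of the two reduced boxes that have $\beta(\mathcal M)\le-\varepsilon$, with these bounds stored. *7. Termination.*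 Stop if $\mathscr R=\emptyset$; otherwise return to step 1. **Theorem 1.** Let $\varepsilon,\eta>0$. With the argument rule, and, if $h_1,\dots,h_K$ are linearly independent, also with the end point rule, the following holds for all choices that the algorithm leaves open. Every step can be carried out, and the algorithm terminates after finitely many iterations. If on termination an incumbent is set, it is an $(\varepsilon,\eta)$-optimal solution of (srmax); if none is set, (srmax) is $\varepsilon$-essential infeasible. -/

import Mathlib

noncomputable section

namespace RSMA

/-- Data of the downlink: `M` antennas, `K` users (the first user is `0 : Fin K`), channels `h`,
rate weights `u`, minimum rates `R`, power budget `P`, amplifier inefficiency `μ` and static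
circuit power `Pc`. -/
structure Network (M K : ℕ) where
  h : Fin K → EuclideanSpace ℂ (Fin M)
  u : Fin K → ℝ
  R : Fin K → ℝ
  P : ℝ
  μ : ℝ
  Pc : ℝ
  h_ne : ∀ k, h k ≠ 0
  u_nonneg : ∀ k, 0 ≤ u k
  u_ne : u ≠ 0
  P_nonneg : 0 ≤ P
  μ_nonneg : 0 ≤ μ
  Pc_pos : 0 < Pc

/-- The users `k > 1`. -/
abbrev Others (K : ℕ) [NeZero K] := {k : Fin K // k ≠ 0}

/-- Beamformers: the common one and the private ones. -/
structure Beam (M K : ℕ) where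
  pc : EuclideanSpace ℂ (Fin M)
  pp : Fin K → EuclideanSpace ℂ (Fin M)

/-- A tuple of all optimization variables. -/
structure Point (M K : ℕ) [NeZero K] where
  beam : Beam M K
  c : Fin K → ℝ
  γ : Fin K → ℝ
  s : ℝ
  d : Others K → ℝ
  e : Others K → ℂ

section Problem

variable {M K : ℕ} [NeZero K] (N : Network M K)

/-- Rates are measured in bits. -/
abbrev lg (x : ℝ) : ℝ := Real.logb 2 x

/-- `h_k^H p`. -/
def rx (k : Fin K) (p : EuclideanSpace ℂ (Fin M)) : ℂ := inner ℂ (N.h k) p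

/-- Total transmit power. -/
def power (y : Beam M K) : ℝ := ‖y.pc‖ ^ 2 + ∑ k, ‖y.pp k‖ ^ 2

/-- Interference plus noise at user `k` when the private message is decoded. -/
def noiseP (y : Beam M K) (k : Fin K) : ℝ :=
  ∑ j ∈ Finset.univ.erase k, ‖rx N k (y.pp j)‖ ^ 2 + 1

/-- Interference plus noise at user `k` when the common message is decoded. -/
def noiseC (y : Beam M K) (k : Fin K) : ℝ := ∑ j, ‖rx N k (y.pp j)‖ ^ 2 + 1

/-- SINR of the common message at user `k`. -/
def sinrC (y : Beam M K) (k : Fin K) : ℝ := ‖rx N k y.pc‖ ^ 2 / noiseC N y k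

/-- SINR of the private message at user `k`. -/
def sinrP (y : Beam M K) (k : Fin K) : ℝ := ‖rx N k (y.pp k)‖ ^ 2 / noiseP N y k

/-- The objective (weighted sum rate over consumed power). -/
def objective (x : Point M K) : ℝ :=
  (∑ k, N.u k * (x.c k + lg (1 + x.γ k))) / (N.μ * power x.beam + N.Pc)

/-- Phase normalization: `h_k^H p_k` and `h_1^H p_c` are real and nonnegative. -/
def PhaseOK (y : Beam M K) : Prop :=
  (∀ k, 0 ≤ (rx N k (y.pp k)).re ∧ (rx N k (y.pp k)).im = 0) ∧
    0 ≤ (rx N 0 y.pc).re ∧ (rx N 0 y.pc).im = 0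

/-- `d_k ≥ 0` and `e_k = h_k^H p_c` for `k > 1`. -/
def AuxOK (x : Point M K) : Prop := ∀ k : Others K, 0 ≤ x.d k ∧ x.e k = rx N k x.beam.pc

/-- Constraints on the common-rate shares `c`, where `ρ k` is the private rate of user `k` and `σ`
the common rate: `∑ c_k ≤ σ` and `c_k ≥ max (0, R_k - ρ_k)`. -/
def RateOK (c ρ : Fin K → ℝ) (σ : ℝ) : Prop :=
  ∑ k, c k ≤ σ ∧ ∀ k, max 0 (N.R k - ρ k) ≤ c k

/-- The second-order cone constraints with SINR levels `γ`, `s`, relaxed by `t`. -/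
def SocOK (y : Beam M K) (d : Others K → ℝ) (γ : Fin K → ℝ) (s t : ℝ) : Prop :=
  (∀ k, √(γ k) * √(noiseP N y k) ≤ t + (rx N k (y.pp k)).re) ∧
  √s * √(noiseC N y 0) ≤ t + (rx N 0 y.pc).re ∧
  ∀ k : Others K, √s * √(noiseC N y k) ≤ t + d k

/-- The set `C` of pairs `(e, d)` with `d ≤ |e|`. -/
def circleSet : Set (ℂ × ℝ) := {q | q.2 ≤ ‖q.1‖}

/-- `x` satisfies all constraints of the problem that are kept as constraints in the dual, and every
function in the maximum that is the dual objective is at most `t` at `x`. -/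
def FeasibleAt (t : ℝ) (x : Point M K) : Prop :=
  PhaseOK N x.beam ∧ AuxOK N x ∧ power x.beam ≤ N.P ∧
  (∀ k, 0 ≤ x.γ k) ∧ 0 ≤ x.s ∧
  RateOK N x.c (fun k => lg (1 + x.γ k)) (lg (1 + x.s)) ∧
  SocOK N x.beam x.d x.γ x.s t ∧
  ∀ k, (x.e k, x.d k - t) ∈ circleSet

/-- Feasibility for the (primal) rate-splitting beamforming problem. -/
def Feasible (x : Point M K) : Prop := FeasibleAt N 0 x

/-- `ε`-essential feasibility: the nonconvex constraints hold with margin `ε`. -/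
def EssentialFeasible (ε : ℝ) (x : Point M K) : Prop := FeasibleAt N (-ε) x

/-- `x` is an (essential) `(ε, η)`-optimal solution. -/
def IsOptimalUpTo (ε η : ℝ) (x : Point M K) : Prop :=
  Feasible N x ∧ ∀ z, EssentialFeasible N ε z → objective N z ≤ objective N x + η

end Problem

section Boxes

/-- Coordinates of the boxes: `γ_p` for every user, `s`, and `α_k` for the users `k > 1`. -/
abbrev Coord (K : ℕ) [NeZero K] := Fin K ⊕ Unit ⊕ Others K

abbrev cγ {K : ℕ} [NeZero K] (k : Fin K) : Coord K := Sum.inl k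
abbrev cs {K : ℕ} [NeZero K] : Coord K := Sum.inr (Sum.inl ())
abbrev cα {K : ℕ} [NeZero K] (k : Others K) : Coord K := Sum.inr (Sum.inr k)

/-- The box `[lo, hi]`, which may be empty. -/
structure Box (K : ℕ) [NeZero K] where
  lo : Coord K → ℝ
  hi : Coord K → ℝ

variable {M K : ℕ} [NeZero K] (N : Network M K)

/-- The initial box. -/
def box0 : Box K where
  lo := fun _ => 0
  hi := Sum.elim (fun k => N.P * ‖N.h k‖ ^ 2)
    (Sum.elim (fun _ => ⨅ k, N.P * ‖N.h k‖ ^ 2) (fun _ => 2 * Real.pi))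

/-- The two halves of a box, bisected along coordinate `j`. -/
def half (b : Box K) (j : Coord K) : Bool → Box K
  | false => ⟨b.lo, Function.update b.hi j ((b.lo j + b.hi j) / 2)⟩
  | true => ⟨Function.update b.lo j ((b.lo j + b.hi j) / 2), b.hi⟩

/-! ### The reduction -/

/-- The lower bound `W` on the consumed power, from lower bounds `lo`. -/
def redW (lo : Coord K → ℝ) : ℝ :=
  N.μ * (lo cs * (⨆ k, (‖N.h k‖ ^ 2)⁻¹) + ∑ k, lo (cγ k) * (‖N.h k‖ ^ 2)⁻¹) + N.Pc

/-- The upper bound `U` on the weighted sum rate. -/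
def redU (b : Box K) : ℝ :=
  (⨆ k, N.u k) * lg (1 + b.hi cs) + ∑ k, N.u k * lg (1 + b.hi (cγ k))

/-- Rate that user `k` needs at least from the common message. -/
def need (b : Box K) (k : Fin K) : ℝ := N.R k - lg (1 + b.hi (cγ k))

/-- `V`, the excess of the required common rate over the available one. -/
def redV (b : Box K) : ℝ :=
  ∑ k with 0 < need N b k, need N b k - lg (1 + b.hi cs)

/-- The lower bound on `γ_{p,k}` implied by feasibility. For `u_k = 0` the bound that comes from the
objective is void. -/
def redγ (δ : ℝ) (b : Box K) (k : Fin K) : ℝ :=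
  let A : ℝ := redW N b.lo * δ - redU N b
  let V : ℝ := redV N b
  if 0 < need N b k then
    (if N.u k = 0 then (2 : ℝ) ^ V else (2 : ℝ) ^ (max (A / N.u k) V)) * (1 + b.hi (cγ k)) - 1
  else
    (if N.u k = 0 then (2 : ℝ) ^ (V + N.R k)
      else max ((2 : ℝ) ^ (A / N.u k) * (1 + b.hi (cγ k))) ((2 : ℝ) ^ (V + N.R k))) - 1

/-- The lower bound on `s` implied by feasibility. -/
def redS (δ : ℝ) (b : Box K) : ℝ :=
  (2 : ℝ) ^ (max ((redW N b.lo * δ - redU N b) / (⨆ k, N.u k)) (redV N b)) * (1 + b.hi cs) - 1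

/-- Lower bounds of the reduced box. -/
def redLo (δ : ℝ) (b : Box K) : Coord K → ℝ :=
  Sum.elim (fun k => max (b.lo (cγ k)) (redγ N δ b k))
    (Sum.elim (fun _ => max (b.lo cs) (redS N δ b)) (fun k => b.lo (cα k)))

/-- Upper bounds of the reduced box (unchanged for `δ μ = 0`). -/
def redHi (δ : ℝ) (b : Box K) : Coord K → ℝ :=
  if δ * N.μ = 0 then b.hi else
  let lo' := redLo N δ b
  let g : ℝ := redU N b - δ * redW N lo'
  Sum.elim (fun k => min (b.hi (cγ k)) (lo' (cγ k) + (δ * N.μ)⁻¹ * ‖N.h k‖ ^ 2 * g))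
    (Sum.elim (fun _ => min (b.hi cs) (lo' cs + (δ * N.μ)⁻¹ * (⨅ k, ‖N.h k‖ ^ 2) * g))
      (fun k => b.hi (cα k)))

/-- The reduced box. -/
def reduce (δ : ℝ) (b : Box K) : Box K := ⟨redLo N δ b, redHi N δ b⟩

/-! ### The bounding problem -/

/-- Convex envelope (argument cut) of `d ≤ |e|` and `∠ e ∈ [l, r]`, for `r - l ≤ π`; here `d` is
already reduced by `t`. -/
def ArgCut (l r : ℝ) (e : ℂ) (d : ℝ) : Prop :=
  let a : ℝ := (Real.cos l + Real.cos r) / 2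
  let b : ℝ := (Real.sin l + Real.sin r) / 2
  Real.sin l * e.re - Real.cos l * e.im ≤ 0 ∧
  0 ≤ Real.sin r * e.re - Real.cos r * e.im ∧
  d * (a ^ 2 + b ^ 2) ≤ a * e.re + b * e.im

/-- Feasible set of the bounding problem over the box `b`. In this problem `x.γ` and `x.s` are
the rates `log (1 + γ)` and `log (1 + s)`. It is infeasible over an empty box. -/
def BndFeasible (δ : ℝ) (b : Box K) (x : Point M K) (t : ℝ) : Prop :=
  (∀ i, b.lo i ≤ b.hi i) ∧
  PhaseOK N x.beam ∧ AuxOK N x ∧ power x.beam ≤ N.P ∧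
  δ * (N.μ * power x.beam + N.Pc) ≤ ∑ k, N.u k * (x.c k + x.γ k) ∧
  RateOK N x.c x.γ x.s ∧
  x.s ∈ Set.Icc (lg (1 + b.lo cs)) (lg (1 + b.hi cs)) ∧
  (∀ k, x.γ k ∈ Set.Icc (lg (1 + b.lo (cγ k))) (lg (1 + b.hi (cγ k)))) ∧
  SocOK N x.beam x.d (fun k => b.lo (cγ k)) (b.lo cs) t ∧
  ∀ k : Others K, b.hi (cα k) - b.lo (cα k) ≤ Real.pi →
    ArgCut (b.lo (cα k)) (b.hi (cα k)) (x.e k) (x.d k - t)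

/-- The bound `β`: the optimal value of the bounding problem, `∞` if it is infeasible. -/
def bound (δ : ℝ) (b : Box K) : EReal :=
  sInf {r : EReal | ∃ (x : Point M K) (t : ℝ), BndFeasible N δ b x t ∧ r = (t : EReal)}

/-! ### Feasible points -/

/-- `∠ e = θ`; every `θ` is an argument of `0`. -/
def IsAngle (e : ℂ) (θ : ℝ) : Prop := e = (‖e‖ : ℂ) * Complex.exp (θ * Complex.I)

/-- The two rules for the angles of the dual feasible point. -/
inductive AngleRule
  /-- the argument of `e_k` itself -/
  | argument
  /-- the end point of the angle interval that is closest to the argument of `e_k` -/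
  | endpoint

/-- `α` is a choice, within `[l, r]`, of the rule for the value `e`. -/
def AngleRule.Picks : AngleRule → ℝ → ℝ → ℂ → ℝ → Prop
  | .argument, l, r, e, α => α ∈ Set.Icc l r ∧ IsAngle e α
  | .endpoint, l, r, e, α => ∃ θ ∈ Set.Icc 0 (2 * Real.pi), IsAngle e θ ∧
      (α = l ∨ α = r) ∧ |α - θ| ≤ |l - θ| ∧ |α - θ| ≤ |r - θ|

/-- Feasible set of the problem that tests the dual feasible point `(γ, s, α)`; the variables are
`x` (with `x.γ = γ` and `x.s = s` fixed) and `t`. -/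
def TestFeasible (δ : ℝ) (γ : Fin K → ℝ) (s : ℝ) (α : Others K → ℝ)
    (x : Point M K) (t : ℝ) : Prop :=
  x.γ = γ ∧ x.s = s ∧
  δ ≤ objective N x ∧
  PhaseOK N x.beam ∧ AuxOK N x ∧ power x.beam ≤ N.P ∧
  RateOK N x.c (fun k => lg (1 + x.γ k)) (lg (1 + x.s)) ∧
  SocOK N x.beam x.d γ s t ∧
  ∀ k, (x.e k, x.d k - t) ∈ circleSet ∧ IsAngle (x.e k) (α k)

/-- The tuple with beamformers `y` and common rates `c`, with `γ_p` and `s` the SINRs of `y`. -/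
def recover (y : Beam M K) (c : Fin K → ℝ) : Point M K where
  beam := y
  c := c
  γ := sinrP N y
  s := ⨅ k, sinrC N y k
  d := fun k => ‖rx N k y.pc‖
  e := fun k => rx N k y.pc

/-- The common rates `c` are admissible for the beamformers `y`. -/
def RatesFor (y : Beam M K) (c : Fin K → ℝ) : Prop :=
  RateOK N c (fun k => lg (1 + sinrP N y k)) (lg (1 + ⨅ k, sinrC N y k))

/-- `c` solves the linear program that optimizes the common rates for beamformers `y`, subject to
the objective being at least `δ`. -/
def BestRates (δ : ℝ) (y : Beam M K) (c : Fin K → ℝ) : Prop :=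
  (RatesFor N y c ∧ δ ≤ objective N (recover N y c)) ∧
  ∀ c', RatesFor N y c' → δ ≤ objective N (recover N y c') →
    ∑ k, N.u k * c' k ≤ ∑ k, N.u k * c k

/-- `o` is a possible result of the feasible point step for the (reduced) box `b`: `some` primal
feasible point, or `none`. -/
def FeasPoint (rule : AngleRule) (δ : ℝ) (b : Box K) (o : Option (Point M K)) : Prop :=
  (0 < bound N δ b ∧ o = none) ∨
  (bound N δ b ≤ 0 ∧
    -- an optimal solution of the bounding problem
    ∃ (x : Point M K) (t : ℝ), BndFeasible N δ b x t ∧ (t : EReal) = bound N δ b ∧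
    -- angles of the dual feasible point
    ∃ α : Others K → ℝ, (∀ k, rule.Picks (b.lo (cα k)) (b.hi (cα k)) (x.e k) (α k)) ∧
    -- an optimal solution of the test problem
    ∃ (z : Point M K) (τ : ℝ),
      TestFeasible N δ (fun k => (2 : ℝ) ^ x.γ k - 1) ((2 : ℝ) ^ x.s - 1) α z τ ∧
      (∀ z' τ', TestFeasible N δ (fun k => (2 : ℝ) ^ x.γ k - 1) ((2 : ℝ) ^ x.s - 1) α z' τ' →
        τ ≤ τ') ∧
      ((0 < τ ∧ o = none) ∨
        (τ ≤ 0 ∧ ∃ c, BestRates N δ z.beam c ∧ o = some (recover N z.beam c))))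

/-- The value `f` of the result of the feasible point step. -/
def value : Option (Point M K) → EReal
  | none => ⊥
  | some x => (objective N x : EReal)

end Boxes

section Algorithm

/-- A box together with the bound that was computed for it. -/
structure Node (K : ℕ) [NeZero K] where
  box : Box K
  β : EReal

/-- State of the algorithm: the current partition, `δ`, and the current best solution (if set). -/
structure State (M K : ℕ) [NeZero K] where
  nodes : Finset (Node K)
  δ : ℝ
  best : Option (Point M K)

variable {M K : ℕ} [NeZero K] (N : Network M K)

/-- Initialization, without or with an initial feasible solution `y`. The bound of the initial box
is immaterial, since this box is the only one. -/
def IsInit (η : ℝ) (S : State M K) : Prop :=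
  S.nodes = {⟨box0 N, ⊥⟩} ∧
  ((S.δ = 0 ∧ S.best = none) ∨
    ∃ (y : Beam M K) (c : Fin K → ℝ), PhaseOK N y ∧ power y ≤ N.P ∧ RatesFor N y c ∧
      (∀ c', RatesFor N y c' → objective N (recover N y c') ≤ objective N (recover N y c)) ∧
      S.δ = η + objective N (recover N y c) ∧ S.best = some (recover N y c))

open Classical in
/-- One iteration of the algorithm. -/
def Step (rule : AngleRule) (ε η : ℝ) (S S' : State M K) : Prop :=
  -- branching
  ∃ n ∈ S.nodes, (∀ n' ∈ S.nodes, n.β ≤ n'.β) ∧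
  ∃ j : Coord K, (∀ i, n.box.hi i - n.box.lo i ≤ n.box.hi j - n.box.lo j) ∧
  -- reduction, bounding and feasible points
  ∃ kid : Bool → Box K, (∀ i, kid i = reduce N S.δ (half n.box j i)) ∧
  ∃ o : Bool → Option (Point M K), (∀ i, FeasPoint N rule S.δ (kid i) (o i)) ∧
  -- incumbent
  (∃ i, (∀ i', value N (o i') ≤ value N (o i)) ∧
    ((((S.δ - η : ℝ) : EReal) < value N (o i) ∧
        ∃ x, o i = some x ∧ S'.best = some x ∧ S'.δ = objective N x + η) ∨
      (value N (o i) ≤ ((S.δ - η : ℝ) : EReal) ∧ S'.best = S.best ∧ S'.δ = S.δ))) ∧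
  -- pruning
  S'.nodes =
    (Finset.univ.image fun i => (⟨kid i, bound N S.δ (kid i)⟩ : Node K)).filter
      (fun m => m.β ≤ ((-ε : ℝ) : EReal)) ∪ S.nodes.erase n

/-- `S` occurs in a run of the algorithm. -/
def Reachable (rule : AngleRule) (ε η : ℝ) (S : State M K) : Prop :=
  ∃ S₀, IsInit N η S₀ ∧ Relation.ReflTransGen (Step N rule ε η) S₀ S

/-- What the algorithm reports when it stops in state `S` is true: either the current best solution
is `(ε, η)`-optimal, or none was set and the problem is `ε`-essential infeasible. -/
def Correct (ε η : ℝ) (S : State M K) : Prop :=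
  match S.best with
  | some x => IsOptimalUpTo N ε η x
  | none => ∀ z, ¬ EssentialFeasible N ε z

end Algorithm

end RSMA

end

/-! Correctness rests on an invariant of the states, `State.Valid`: the boxes still kept cover every
`ε`-essential feasible point of value at least `δ`, for every choice of arguments of its gains `e_k`
in `[0, 2π]`. A branching step preserves it for two reasons. The reduction cuts off only infeasible
points and points of value below `δ` (`mem_reduce`). The bounding problem is a relaxation in which
such a point, with its SINR levels turned into rates, is feasible at `t = -ε`, so its box has bound
at most `-ε` and is kept (`bound_le_of_mem`). When no box is left, every essential feasible point
has value below `δ`. With an incumbent, `δ` is its value plus `η`; without one, `δ = 0`, and since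
the objective is nonnegative on feasible points, no essential feasible point exists.

No step gets stuck, because both minimization problems attain their minima: `e` is determined by the
common beamformer, `d` can be lowered to its least admissible value, and the remaining variables
with `t` bounded above form a compact set (`exists_minimizer`). The test problem always has a point,
namely a zero common beamformer, since zero has every argument, with `t` large
(`BndFeasible.exists_test`).

For termination, the key is that a sufficiently small box with bound at most `-ε` has a candidate
(`exists_small_box_size`). The slack `ε` of the bounding solution pays for raising the SINR levels
from the lower corner of the box to the chosen levels, for replacing the chord of the argument cut
by the circle, and for turning the gains to the prescribed angles. The last item costs nothing under
the argument rule. Under the end point rule it uses linear independence, which allows all gains to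
be changed slightly and then scaled by a common factor without more power (`exists_perturbation`).

Each candidate has value at least `δ`, so accepting it raises `δ` by at least `η`; as the objective
is bounded, this happens finitely often. In between, the potential `∑ 3 ^ boxSize` decreases
(`Step.potential_lt`). Hence a lexicographic pair of natural numbers decreases along a run. -/

namespace RSMA

/-! ### Gains, noise terms, SINR levels and rates. -/

section Basics

variable {M K : ℕ} (N : Network M K)

lemma norm_rx_le (k : Fin K) (p : EuclideanSpace ℂ (Fin M)) : ‖rx N k p‖ ≤ ‖N.h k‖ * ‖p‖ :=
  norm_inner_le_norm _ _

lemma norm_rx_sq_le (k : Fin K) (p : EuclideanSpace ℂ (Fin M)) :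
    ‖rx N k p‖ ^ 2 ≤ ‖N.h k‖ ^ 2 * ‖p‖ ^ 2 := by
  rw [← mul_pow]
  exact pow_le_pow_left₀ (norm_nonneg _) (norm_rx_le N k p) 2

lemma norm_h_pos (k : Fin K) : 0 < ‖N.h k‖ := norm_pos_iff.2 (N.h_ne k)

lemma power_nonneg (y : Beam M K) : 0 ≤ power y := by
  unfold power; positivity

lemma norm_pc_sq_le_power (y : Beam M K) : ‖y.pc‖ ^ 2 ≤ power y := by
  unfold power
  have : 0 ≤ ∑ k, ‖y.pp k‖ ^ 2 := by positivity
  linarith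

lemma norm_pp_sq_le_power (y : Beam M K) (k : Fin K) : ‖y.pp k‖ ^ 2 ≤ power y := by
  unfold power
  have h := Finset.single_le_sum (f := fun k => ‖y.pp k‖ ^ 2) (fun i _ => by positivity)
    (Finset.mem_univ k)
  have : 0 ≤ ‖y.pc‖ ^ 2 := by positivity
  linarith

lemma cost_pos (y : Beam M K) : 0 < N.μ * power y + N.Pc :=
  add_pos_of_nonneg_of_pos (mul_nonneg N.μ_nonneg (power_nonneg y)) N.Pc_pos

lemma one_le_noiseP (y : Beam M K) (k : Fin K) : 1 ≤ noiseP N y k := by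
  unfold noiseP
  have : 0 ≤ ∑ j ∈ Finset.univ.erase k, ‖rx N k (y.pp j)‖ ^ 2 := by positivity
  linarith

lemma one_le_noiseC (y : Beam M K) (k : Fin K) : 1 ≤ noiseC N y k := by
  unfold noiseC
  have : 0 ≤ ∑ j, ‖rx N k (y.pp j)‖ ^ 2 := by positivity
  linarith

lemma noiseP_le_noiseC (y : Beam M K) (k : Fin K) : noiseP N y k ≤ noiseC N y k := by
  unfold noiseP noiseC
  have := Finset.sum_le_sum_of_subset_of_nonneg (Finset.erase_subset k Finset.univ)
    (f := fun j => ‖rx N k (y.pp j)‖ ^ 2) (fun i _ _ => by positivity)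
  linarith

/-- An upper bound on the interference plus noise of all users. -/
noncomputable def noiseBound : ℝ := (∑ k, ‖N.h k‖ ^ 2) * N.P + 1

/-- An upper bound on the gains of all users. -/
noncomputable def gainBound : ℝ := (∑ k, ‖N.h k‖) * √N.P

lemma gainBound_nonneg : 0 ≤ gainBound N := by unfold gainBound; positivity

lemma noiseBound_pos : 0 < noiseBound N := by
  unfold noiseBound
  have := N.P_nonneg
  positivity

lemma noiseC_le (y : Beam M K) (hy : power y ≤ N.P) (k : Fin K) : noiseC N y k ≤ noiseBound N := by
  unfold noiseC noiseBound
  have h1 : ∑ j, ‖rx N k (y.pp j)‖ ^ 2 ≤ ‖N.h k‖ ^ 2 * ∑ j, ‖y.pp j‖ ^ 2 := by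
    rw [Finset.mul_sum]
    exact Finset.sum_le_sum fun j _ => norm_rx_sq_le N k _
  have h2 : ∑ j, ‖y.pp j‖ ^ 2 ≤ N.P := by
    refine le_trans ?_ hy
    unfold power
    have : 0 ≤ ‖y.pc‖ ^ 2 := by positivity
    linarith
  have h3 : ‖N.h k‖ ^ 2 ≤ ∑ k, ‖N.h k‖ ^ 2 :=
    Finset.single_le_sum (f := fun k => ‖N.h k‖ ^ 2) (fun i _ => by positivity) (Finset.mem_univ k)
  have h4 : ‖N.h k‖ ^ 2 * ∑ j, ‖y.pp j‖ ^ 2 ≤ (∑ k, ‖N.h k‖ ^ 2) * N.P :=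
    mul_le_mul h3 h2 (by positivity) (by positivity)
  linarith

lemma norm_rx_le_gainBound (k : Fin K) (p : EuclideanSpace ℂ (Fin M)) (hp : ‖p‖ ^ 2 ≤ N.P) :
    ‖rx N k p‖ ≤ gainBound N := by
  refine (norm_rx_le N k p).trans ?_
  unfold gainBound
  have h3 : ‖N.h k‖ ≤ ∑ k, ‖N.h k‖ :=
    Finset.single_le_sum (f := fun k => ‖N.h k‖) (fun i _ => by positivity) (Finset.mem_univ k)
  exact mul_le_mul h3 (Real.le_sqrt_of_sq_le hp) (norm_nonneg _) (by positivity)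

lemma norm_eq_re {e : ℂ} (h : 0 ≤ e.re ∧ e.im = 0) : ‖e‖ = e.re := by
  have : e = (e.re : ℂ) := Complex.ext rfl (by simp [h.2])
  rw [this, Complex.norm_real, Real.norm_eq_abs, Complex.ofReal_re, abs_of_nonneg h.1]

lemma sinrP_nonneg (y : Beam M K) (k : Fin K) : 0 ≤ sinrP N y k :=
  div_nonneg (by positivity) (zero_le_one.trans (one_le_noiseP N y k))

lemma sinrC_nonneg (y : Beam M K) (k : Fin K) : 0 ≤ sinrC N y k :=
  div_nonneg (by positivity) (zero_le_one.trans (one_le_noiseC N y k))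

lemma le_div_of_sqrt_mul_sqrt_le {γ J a : ℝ} (hγ : 0 ≤ γ) (hJ : 1 ≤ J) (h : √γ * √J ≤ a) :
    γ ≤ a ^ 2 / J := by
  rw [le_div_iff₀ (by linarith)]
  have h2 := pow_le_pow_left₀ (by positivity) h 2
  rwa [mul_pow, Real.sq_sqrt hγ, Real.sq_sqrt (by linarith)] at h2

lemma sqrt_div_mul_sqrt {J a : ℝ} (ha : 0 ≤ a) (hJ : 1 ≤ J) : √(a ^ 2 / J) * √J = a := by
  rw [← Real.sqrt_mul (by positivity), div_mul_cancel₀ _ (by linarith), Real.sqrt_sq ha]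

lemma lg_mono {x y : ℝ} (hx : 0 < x) (h : x ≤ y) : lg x ≤ lg y :=
  Real.logb_le_logb_of_le one_lt_two hx h

lemma lg_one_add_nonneg {x : ℝ} (hx : 0 ≤ x) : 0 ≤ lg (1 + x) :=
  Real.logb_nonneg one_lt_two (by linarith)

lemma lg_rpow (x : ℝ) : lg (1 + ((2 : ℝ) ^ x - 1)) = x := by
  rw [add_sub_cancel]
  exact Real.logb_rpow two_pos (by norm_num)

lemma RateOK.mono {c ρ ρ' : Fin K → ℝ} {σ σ' : ℝ} (h : RateOK N c ρ σ) (hρ : ∀ k, ρ k ≤ ρ' k)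
    (hσ : σ ≤ σ') : RateOK N c ρ' σ' :=
  ⟨h.1.trans hσ, fun k => (max_le_max le_rfl (by linarith [hρ k])).trans (h.2 k)⟩

lemma RateOK.nonneg {c ρ : Fin K → ℝ} {σ : ℝ} (h : RateOK N c ρ σ) (k : Fin K) : 0 ≤ c k :=
  (le_max_left _ _).trans (h.2 k)

lemma RateOK.le {c ρ : Fin K → ℝ} {σ : ℝ} (h : RateOK N c ρ σ) (k : Fin K) : c k ≤ σ :=
  (Finset.single_le_sum (fun i _ => h.nonneg N i) (Finset.mem_univ k)).trans h.1

variable [NeZero K]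

/-- The SOC constraints with `t ≤ 0` bound the SINR levels by the actual SINRs. -/
lemma le_sinr_of_soc {y : Beam M K} {d : Others K → ℝ} {γ : Fin K → ℝ} {s t : ℝ}
    (hy : PhaseOK N y) (hγ : ∀ k, 0 ≤ γ k) (hs : 0 ≤ s) (ht : t ≤ 0) (hsoc : SocOK N y d γ s t)
    (hd : ∀ k : Others K, d k - t ≤ ‖rx N k y.pc‖) :
    (∀ k, γ k ≤ sinrP N y k) ∧ ∀ k, s ≤ sinrC N y k := by
  obtain ⟨h1, h2, h3⟩ := hsoc
  refine ⟨fun k => le_div_of_sqrt_mul_sqrt_le (hγ k) (one_le_noiseP N y k) ?_, fun k =>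
    le_div_of_sqrt_mul_sqrt_le hs (one_le_noiseC N y k) ?_⟩
  · rw [norm_eq_re (hy.1 k)]
    linarith [h1 k]
  · by_cases hk : k = 0
    · subst hk
      rw [norm_eq_re hy.2]
      linarith
    · have a := h3 ⟨k, hk⟩
      have b := hd ⟨k, hk⟩
      simp only at a b
      linarith

lemma objective_nonneg {x : Point M K} (hc : ∀ k, 0 ≤ x.c k) (hγ : ∀ k, 0 ≤ x.γ k) :
    0 ≤ objective N x :=
  div_nonneg (Finset.sum_nonneg fun k _ => mul_nonneg (N.u_nonneg k)
    (add_nonneg (hc k) (lg_one_add_nonneg (hγ k)))) (cost_pos N _).le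

lemma le_objective_iff {δ : ℝ} {x : Point M K} : δ ≤ objective N x ↔
    δ * (N.μ * power x.beam + N.Pc) ≤ ∑ k, N.u k * (x.c k + lg (1 + x.γ k)) :=
  le_div_iff₀ (cost_pos N _)

/-- With the levels set to the actual SINRs, the private cone constraints are equalities; the common
ones follow because `s` is the least common SINR. -/
lemma recover_feasible {y : Beam M K} {c : Fin K → ℝ} (hy : PhaseOK N y) (hp : power y ≤ N.P)
    (hc : RatesFor N y c) : Feasible N (recover N y c) := by
  have hs : ∀ k, ⨅ k, sinrC N y k ≤ sinrC N y k := fun k => ciInf_le (Finite.bddBelow_range _) k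
  have hc' : ∀ k, √(⨅ k, sinrC N y k) * √(noiseC N y k) ≤ ‖rx N k y.pc‖ := fun k => by
    refine (mul_le_mul_of_nonneg_right (Real.sqrt_le_sqrt (hs k)) (Real.sqrt_nonneg _)).trans ?_
    exact (sqrt_div_mul_sqrt (norm_nonneg _) (one_le_noiseC N y k)).le
  refine ⟨hy, fun k => ⟨norm_nonneg _, rfl⟩, hp, sinrP_nonneg N y,
    Real.iInf_nonneg (sinrC_nonneg N y), hc, ⟨fun k => ?_, ?_, fun k => ?_⟩, fun k => ?_⟩
  · rw [zero_add]
    change √(sinrP N y k) * _ ≤ (rx N k (y.pp k)).re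
    rw [← norm_eq_re (hy.1 k)]
    exact (sqrt_div_mul_sqrt (norm_nonneg _) (one_le_noiseP N y k)).le
  · rw [zero_add]
    change _ ≤ (rx N 0 y.pc).re
    rw [← norm_eq_re hy.2]
    exact hc' 0
  · rw [zero_add]
    exact hc' k
  · simp [circleSet, recover]

end Basics

/-! ### Arguments of complex numbers and the argument cut. -/

section Angles

lemma IsAngle.re {e : ℂ} {θ : ℝ} (h : IsAngle e θ) : e.re = ‖e‖ * Real.cos θ := by
  conv_lhs => rw [h]
  simp [Complex.exp_ofReal_mul_I_re]

lemma IsAngle.im {e : ℂ} {θ : ℝ} (h : IsAngle e θ) : e.im = ‖e‖ * Real.sin θ := by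
  conv_lhs => rw [h]
  simp [Complex.exp_ofReal_mul_I_im]

lemma isAngle_zero (θ : ℝ) : IsAngle 0 θ := by simp [IsAngle]

lemma isAngle_mul_exp {r : ℝ} (hr : 0 ≤ r) (θ : ℝ) :
    IsAngle ((r : ℂ) * Complex.exp (θ * Complex.I)) θ := by
  unfold IsAngle
  rw [norm_mul, Complex.norm_exp_ofReal_mul_I, mul_one, Complex.norm_real, Real.norm_eq_abs,
    abs_of_nonneg hr]

lemma exists_isAngle_Ico (e : ℂ) (l : ℝ) : ∃ θ ∈ Set.Ico l (l + 2 * Real.pi), IsAngle e θ := by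
  refine ⟨toIcoMod Real.two_pi_pos l e.arg, toIcoMod_mem_Ico _ _ _, ?_⟩
  unfold IsAngle
  have h : toIcoMod Real.two_pi_pos l e.arg
      = e.arg - toIcoDiv Real.two_pi_pos l e.arg * (2 * Real.pi) := by
    rw [toIcoMod, zsmul_eq_mul]
  rw [h]
  conv_lhs => rw [← Complex.norm_mul_exp_arg_mul_I e]
  congr 1
  rw [Complex.exp_eq_exp_iff_exists_int]
  exact ⟨toIcoDiv Real.two_pi_pos l e.arg, by push_cast; ring⟩

lemma exists_isAngle (e : ℂ) : ∃ θ ∈ Set.Icc 0 (2 * Real.pi), IsAngle e θ := by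
  obtain ⟨θ, h, h'⟩ := exists_isAngle_Ico e 0
  exact ⟨θ, ⟨h.1, by linarith [h.2]⟩, h'⟩

/-- The first two inequalities of the argument cut describe the sector of angles in `[l, r]`. -/
lemma exists_isAngle_of_cut {l r : ℝ} (hlr : l < r) {e : ℂ}
    (h1 : Real.sin l * e.re - Real.cos l * e.im ≤ 0)
    (h2 : 0 ≤ Real.sin r * e.re - Real.cos r * e.im) : ∃ φ ∈ Set.Icc l r, IsAngle e φ := by
  obtain ⟨φ, ⟨hl, hu⟩, hφ⟩ := exists_isAngle_Ico e l
  by_cases he : e = 0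
  · exact ⟨l, ⟨le_rfl, hlr.le⟩, by rw [he]; exact isAngle_zero l⟩
  have hn : 0 < ‖e‖ := norm_pos_iff.2 he
  rw [hφ.re, hφ.im] at h1 h2
  have h1' : 0 ≤ Real.sin (φ - l) := by
    rw [Real.sin_sub]; by_contra! hc; nlinarith [mul_neg_of_pos_of_neg hn hc]
  have h2' : Real.sin (φ - r) ≤ 0 := by
    rw [Real.sin_sub]; by_contra! hc; nlinarith [mul_pos hn hc]
  have h3 : φ - l ≤ Real.pi := by
    by_contra! hc
    have : 0 < Real.sin (φ - l - Real.pi) :=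
      Real.sin_pos_of_pos_of_lt_pi (by linarith) (by linarith)
    rw [Real.sin_sub_pi] at this
    linarith
  refine ⟨φ, ⟨hl, ?_⟩, hφ⟩
  -- The strict inequality `l < r` gives `φ - r < φ - l ≤ π`, so the sine is positive. For `l = r`
  -- the opposite ray would satisfy both inequalities as well.
  by_contra! hc
  exact absurd (Real.sin_pos_of_pos_of_lt_pi (x := φ - r) (by linarith) (by linarith)) h2'.not_gt

/-- The midpoint `(a, b)` of the chord between the end points of the arc lies on the bisecting
direction, at distance `cos ((r - l) / 2)` from zero when this is nonnegative. -/
lemma argCut_iff (l r : ℝ) (e : ℂ) (d : ℝ) : ArgCut l r e d ↔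
    Real.sin l * e.re - Real.cos l * e.im ≤ 0 ∧ 0 ≤ Real.sin r * e.re - Real.cos r * e.im ∧
    d * Real.cos ((r - l) / 2) ^ 2 ≤ Real.cos ((r - l) / 2) *
      (Real.cos ((l + r) / 2) * e.re + Real.sin ((l + r) / 2) * e.im) := by
  have ha : (Real.cos l + Real.cos r) / 2 = Real.cos ((r - l) / 2) * Real.cos ((l + r) / 2) := by
    rw [Real.cos_add_cos, ← Real.cos_neg ((l - r) / 2)]
    ring_nf
  have hb : (Real.sin l + Real.sin r) / 2 = Real.cos ((r - l) / 2) * Real.sin ((l + r) / 2) := by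
    rw [Real.sin_add_sin, ← Real.cos_neg ((l - r) / 2)]
    ring_nf
  unfold ArgCut
  simp only [ha, hb]
  have hc : (Real.cos ((r - l) / 2) * Real.cos ((l + r) / 2)) ^ 2 +
      (Real.cos ((r - l) / 2) * Real.sin ((l + r) / 2)) ^ 2 = Real.cos ((r - l) / 2) ^ 2 := by
    rw [mul_pow, mul_pow, ← mul_add, Real.cos_sq_add_sin_sq, mul_one]
  rw [hc, mul_add, ← mul_assoc, ← mul_assoc]

/-- The argument cut is valid. -/
lemma argCut_of_isAngle {l r θ : ℝ} (hπ : r - l ≤ Real.pi) (hθ : θ ∈ Set.Icc l r) {e : ℂ}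
    (he : IsAngle e θ) {d : ℝ} (hd : d ≤ ‖e‖) : ArgCut l r e d := by
  obtain ⟨h1, h2⟩ := hθ
  rw [argCut_iff, he.re, he.im]
  have hn := norm_nonneg e
  refine ⟨?_, ?_, ?_⟩
  · have : 0 ≤ Real.sin (θ - l) := Real.sin_nonneg_of_nonneg_of_le_pi (by linarith) (by linarith)
    rw [Real.sin_sub] at this
    nlinarith [mul_nonneg hn this]
  · have : 0 ≤ Real.sin (r - θ) := Real.sin_nonneg_of_nonneg_of_le_pi (by linarith) (by linarith)
    rw [Real.sin_sub] at this
    nlinarith [mul_nonneg hn this]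
  -- An angle in the interval differs from the bisector by at most half the width, so the projection
  -- of `e` onto the bisector has length at least `‖e‖ cos ((r - l) / 2)`.
  · have h3 : Real.cos ((r - l) / 2) ≤ Real.cos (θ - (l + r) / 2) := by
      rw [← Real.cos_abs (θ - (l + r) / 2)]
      refine Real.cos_le_cos_of_nonneg_of_le_pi (abs_nonneg _) (by linarith [Real.pi_pos]) ?_
      rw [abs_le]
      constructor <;> linarith
    have h4 : 0 ≤ Real.cos ((r - l) / 2) :=
      Real.cos_nonneg_of_mem_Icc ⟨by linarith [Real.pi_pos], by linarith⟩
    have h5 : Real.cos ((l + r) / 2) * (‖e‖ * Real.cos θ) +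
        Real.sin ((l + r) / 2) * (‖e‖ * Real.sin θ) = ‖e‖ * Real.cos (θ - (l + r) / 2) := by
      rw [Real.cos_sub]; ring
    rw [h5]
    calc d * Real.cos ((r - l) / 2) ^ 2 ≤ ‖e‖ * Real.cos ((r - l) / 2) ^ 2 := by gcongr
      _ = Real.cos ((r - l) / 2) * (‖e‖ * Real.cos ((r - l) / 2)) := by ring
      _ ≤ _ := by gcongr

/-- What the argument cut says about `d`. -/
lemma ArgCut.mul_cos_le {l r : ℝ} {e : ℂ} {d : ℝ} (h : ArgCut l r e d)
    (hc : 0 < Real.cos ((r - l) / 2)) : d * Real.cos ((r - l) / 2) ≤ ‖e‖ := by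
  obtain ⟨-, -, h3⟩ := (argCut_iff l r e d).1 h
  obtain ⟨φ, -, hφ⟩ := exists_isAngle e
  rw [hφ.re, hφ.im] at h3
  have h5 : Real.cos ((l + r) / 2) * (‖e‖ * Real.cos φ) +
      Real.sin ((l + r) / 2) * (‖e‖ * Real.sin φ) = ‖e‖ * Real.cos (φ - (l + r) / 2) := by
    rw [Real.cos_sub]; ring
  have h6 : ‖e‖ * Real.cos (φ - (l + r) / 2) ≤ ‖e‖ :=
    mul_le_of_le_one_right (norm_nonneg _) (Real.cos_le_one _)
  rw [h5] at h3
  refine le_trans (le_of_mul_le_mul_left ?_ hc) h6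
  linarith

lemma ArgCut.mono {l r : ℝ} {e : ℂ} {d d' : ℝ} (h : ArgCut l r e d) (hd : d' ≤ d) :
    ArgCut l r e d' :=
  ⟨h.1, h.2.1, (mul_le_mul_of_nonneg_right hd (by positivity)).trans h.2.2⟩

end Angles

/-! ### Validity of the reduction and of the bound. -/

section Weights

variable {M K : ℕ} (N : Network M K)

lemma u_le_iSup (k : Fin K) : N.u k ≤ ⨆ k, N.u k := le_ciSup (Finite.bddAbove_range _) k

lemma iSup_u_pos : 0 < ⨆ k, N.u k := by
  obtain ⟨k, hk⟩ := Function.ne_iff.1 N.u_ne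
  exact lt_of_lt_of_le (lt_of_le_of_ne (N.u_nonneg k) (Ne.symm hk)) (u_le_iSup N k)

end Weights

section Reduction

variable {M K : ℕ} [NeZero K] {N : Network M K}

/-- The box coordinates of SINR levels `γ`, `s` and angles `α`. -/
def coords (γ : Fin K → ℝ) (s : ℝ) (α : Others K → ℝ) : Coord K → ℝ :=
  Sum.elim γ (Sum.elim (fun _ => s) α)

/-- Membership in a box. -/
def Box.Mem (b : Box K) (v : Coord K → ℝ) : Prop := ∀ i, v i ∈ Set.Icc (b.lo i) (b.hi i)

lemma rpow_mul_le {a x y : ℝ} (hx : 0 < x) (hy : 0 < y) (h : a ≤ lg y - lg x) :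
    (2 : ℝ) ^ a * x ≤ y := by
  have hx' : (2 : ℝ) ^ lg x = x := Real.rpow_logb two_pos (by norm_num) hx
  calc (2 : ℝ) ^ a * x = 2 ^ (a + lg x) := by rw [Real.rpow_add two_pos, hx']
    _ ≤ y := (Real.le_logb_iff_rpow_le one_lt_two hy).1 (by linarith)

lemma rpow_le {a y : ℝ} (hy : 0 < y) (h : a ≤ lg y) : (2 : ℝ) ^ a ≤ y :=
  (Real.le_logb_iff_rpow_le one_lt_two hy).1 h

lemma Feasible.le_sinr {x : Point M K} (hx : Feasible N x) :
    (∀ k, x.γ k ≤ sinrP N x.beam k) ∧ ∀ k, x.s ≤ sinrC N x.beam k := by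
  obtain ⟨h1, h2, -, h4, h5, -, h7, h8⟩ := hx
  refine le_sinr_of_soc N h1 h4 h5 le_rfl h7 fun k => ?_
  rw [← (h2 k).2]
  exact h8 k

lemma Feasible.γ_le {x : Point M K} (hx : Feasible N x) (k : Fin K) :
    x.γ k ≤ ‖N.h k‖ ^ 2 * ‖x.beam.pp k‖ ^ 2 :=
  (hx.le_sinr.1 k).trans ((div_le_self (by positivity) (one_le_noiseP N _ k)).trans
    (norm_rx_sq_le N k _))

lemma Feasible.s_le {x : Point M K} (hx : Feasible N x) (k : Fin K) :
    x.s ≤ ‖N.h k‖ ^ 2 * ‖x.beam.pc‖ ^ 2 :=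
  (hx.le_sinr.2 k).trans ((div_le_self (by positivity) (one_le_noiseC N _ k)).trans
    (norm_rx_sq_le N k _))

lemma redW_mono {v w : Coord K → ℝ} (h : ∀ i, v i ≤ w i) : redW N v ≤ redW N w := by
  unfold redW
  have := N.μ_nonneg
  have h0 : 0 ≤ ⨆ k, (‖N.h k‖ ^ 2)⁻¹ := Real.iSup_nonneg fun k => by positivity
  gcongr <;> exact h _

/-- Cauchy–Schwarz prices each level in transmit power. The level `s` has to be reached by all
users, so the weakest channel decides. -/
lemma redW_le_cost {x : Point M K} (hx : Feasible N x) (α : Others K → ℝ) :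
    redW N (coords x.γ x.s α) ≤ N.μ * power x.beam + N.Pc := by
  unfold redW power
  have := N.μ_nonneg
  gcongr with k
  · obtain ⟨k, hk⟩ := exists_eq_ciSup_of_finite (f := fun k => (‖N.h k‖ ^ 2)⁻¹)
    rw [← hk, ← div_eq_mul_inv, div_le_iff₀ (pow_pos (norm_h_pos N k) 2), mul_comm]
    exact hx.s_le k
  · rw [← div_eq_mul_inv, div_le_iff₀ (pow_pos (norm_h_pos N k) 2), mul_comm]
    exact hx.γ_le k

/-- Weighted sum rate in terms of the box coordinates. -/
lemma mul_redW_le {x : Point M K} (hx : Feasible N x) (α : Others K → ℝ) {δ : ℝ} (hδ : 0 ≤ δ)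
    (hobj : δ ≤ objective N x) : δ * redW N (coords x.γ x.s α) ≤
      (⨆ k, N.u k) * lg (1 + x.s) + ∑ k, N.u k * lg (1 + x.γ k) := by
  refine (mul_le_mul_of_nonneg_left (redW_le_cost hx α) hδ).trans
    (((le_objective_iff N).1 hobj).trans ?_)
  have hr := hx.2.2.2.2.2.1
  simp only [mul_add, Finset.sum_add_distrib]
  have h1 : ∑ k, N.u k * x.c k ≤ (⨆ k, N.u k) * ∑ k, x.c k := by
    rw [Finset.mul_sum]
    exact Finset.sum_le_sum fun k _ =>
      mul_le_mul_of_nonneg_right (u_le_iSup N k) (hr.nonneg N k)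
  have h2 := mul_le_mul_of_nonneg_left hr.1 (iSup_u_pos N).le
  linarith

variable {x : Point M K} {b : Box K} {α : Others K → ℝ} {δ : ℝ}

lemma lg_γ_le (hx : Feasible N x) (hb : b.Mem (coords x.γ x.s α)) (k : Fin K) :
    lg (1 + x.γ k) ≤ lg (1 + b.hi (cγ k)) :=
  lg_mono (by linarith [hx.2.2.2.1 k]) (by linarith [show x.γ k ≤ _ from (hb (cγ k)).2])

lemma lg_s_le (hx : Feasible N x) (hb : b.Mem (coords x.γ x.s α)) :
    lg (1 + x.s) ≤ lg (1 + b.hi cs) :=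
  lg_mono (by linarith [hx.2.2.2.2.1]) (by linarith [show x.s ≤ _ from (hb cs).2])

/-- The weighted rate must pay for at least `δ * W`, while `U` is the most that the box offers. All
terms on the right are nonpositive, so any one of them may be kept alone; this gives `gap_γ` and
`gap_s`. -/
lemma sum_rate_gap (hx : Feasible N x) (hb : b.Mem (coords x.γ x.s α)) (hδ : 0 ≤ δ)
    (hobj : δ ≤ objective N x) :
    redW N b.lo * δ - redU N b ≤ (⨆ k, N.u k) * (lg (1 + x.s) - lg (1 + b.hi cs)) +
      ∑ k, N.u k * (lg (1 + x.γ k) - lg (1 + b.hi (cγ k))) := by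
  have h1 := mul_redW_le hx α hδ hobj
  have h2 := mul_le_mul_of_nonneg_left (redW_mono (N := N) fun i => (hb i).1) hδ
  unfold redU
  simp only [mul_sub, Finset.sum_sub_distrib]
  linarith

lemma gap_γ (hx : Feasible N x) (hb : b.Mem (coords x.γ x.s α)) (hδ : 0 ≤ δ)
    (hobj : δ ≤ objective N x) (k : Fin K) :
    redW N b.lo * δ - redU N b ≤ N.u k * (lg (1 + x.γ k) - lg (1 + b.hi (cγ k))) := by
  have h1 := sum_rate_gap hx hb hδ hobj
  have h2 := mul_nonneg (iSup_u_pos N).le (sub_nonneg.2 (lg_s_le hx hb))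
  have h3 := Finset.single_le_sum
    (f := fun k => N.u k * (lg (1 + b.hi (cγ k)) - lg (1 + x.γ k)))
    (fun i _ => mul_nonneg (N.u_nonneg i) (sub_nonneg.2 (lg_γ_le hx hb i))) (Finset.mem_univ k)
  simp only [mul_sub, Finset.sum_sub_distrib] at h1 h2 h3 ⊢
  linarith

lemma gap_s (hx : Feasible N x) (hb : b.Mem (coords x.γ x.s α)) (hδ : 0 ≤ δ)
    (hobj : δ ≤ objective N x) :
    redW N b.lo * δ - redU N b ≤ (⨆ k, N.u k) * (lg (1 + x.s) - lg (1 + b.hi cs)) := by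
  have h1 := sum_rate_gap hx hb hδ hobj
  have h3 : 0 ≤ ∑ k, N.u k * (lg (1 + b.hi (cγ k)) - lg (1 + x.γ k)) :=
    Finset.sum_nonneg
    (fun i _ => mul_nonneg (N.u_nonneg i) (sub_nonneg.2 (lg_γ_le hx hb i)))
  simp only [mul_sub, Finset.sum_sub_distrib] at h1 h3 ⊢
  linarith

lemma need_le (hx : Feasible N x) (hb : b.Mem (coords x.γ x.s α)) (k : Fin K) :
    need N b k ≤ N.R k - lg (1 + x.γ k) := by
  unfold need
  linarith [lg_γ_le hx hb k]

lemma rate_le_c (hx : Feasible N x) (k : Fin K) : N.R k - lg (1 + x.γ k) ≤ x.c k :=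
  (le_max_right _ _).trans (hx.2.2.2.2.2.1.2 k)

lemma redV_le (hx : Feasible N x) (hb : b.Mem (coords x.γ x.s α)) :
    redV N b ≤ lg (1 + x.s) - lg (1 + b.hi cs) := by
  have hr := hx.2.2.2.2.2.1
  have h1 : ∑ k with 0 < need N b k, need N b k ≤ ∑ k with 0 < need N b k, x.c k :=
    Finset.sum_le_sum fun k _ => (need_le hx hb k).trans (rate_le_c hx k)
  have h2 : ∑ k with 0 < need N b k, x.c k ≤ ∑ k, x.c k :=
    Finset.sum_le_sum_of_subset_of_nonneg (Finset.subset_univ _) fun i _ _ => hr.nonneg N i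
  unfold redV
  linarith [hr.1]

/-- A private rate of user `k` below its maximum over the box has to be made up by common rate
beyond `need`, and the total of such surplus is at most `-V`. -/
lemma redV_le_of_need_pos (hx : Feasible N x) (hb : b.Mem (coords x.γ x.s α)) {k : Fin K}
    (hk : 0 < need N b k) : redV N b ≤ lg (1 + x.γ k) - lg (1 + b.hi (cγ k)) := by
  have hr := hx.2.2.2.2.2.1
  have h1 := Finset.single_le_sum (s := Finset.univ.filter fun k => 0 < need N b k)
    (f := fun k => x.c k - need N b k)
    (fun k _ => sub_nonneg.2 ((need_le hx hb k).trans (rate_le_c hx k)))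
    (Finset.mem_filter.2 ⟨Finset.mem_univ k, hk⟩)
  simp only [Finset.sum_sub_distrib] at h1
  have h2 : ∑ k with 0 < need N b k, x.c k ≤ ∑ k, x.c k :=
    Finset.sum_le_sum_of_subset_of_nonneg (Finset.subset_univ _) fun i _ _ => hr.nonneg N i
  have h3 := rate_le_c hx k
  have h4 := lg_s_le hx hb
  have h5 : need N b k = N.R k - lg (1 + b.hi (cγ k)) := rfl
  have h6 := hr.1
  unfold redV
  linarith

/-- User `k` does not occur in the sum that defines `V`, so its own demand on the common rate can be
added to that sum. -/
lemma redV_add_le (hx : Feasible N x) (hb : b.Mem (coords x.γ x.s α)) {k : Fin K}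
    (hk : ¬ 0 < need N b k) : redV N b + N.R k ≤ lg (1 + x.γ k) := by
  have hr := hx.2.2.2.2.2.1
  have h1 : ∑ k with 0 < need N b k, need N b k ≤ ∑ k with 0 < need N b k, x.c k :=
    Finset.sum_le_sum fun k _ => (need_le hx hb k).trans (rate_le_c hx k)
  have h2 : ∑ k ∈ insert k (Finset.univ.filter fun k => 0 < need N b k), x.c k ≤ ∑ k, x.c k :=
    Finset.sum_le_sum_of_subset_of_nonneg (Finset.subset_univ _) fun i _ _ => hr.nonneg N i
  rw [Finset.sum_insert (by simpa using hk)] at h2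
  have h3 := rate_le_c hx k
  have h4 := lg_s_le hx hb
  have h6 := hr.1
  unfold redV
  linarith

lemma redγ_le (hx : Feasible N x) (hb : b.Mem (coords x.γ x.s α)) (hδ : 0 ≤ δ)
    (hobj : δ ≤ objective N x) (k : Fin K) : redγ N δ b k ≤ x.γ k := by
  have hγ : 0 < 1 + x.γ k := by linarith [hx.2.2.2.1 k]
  have hγ' : 0 < 1 + b.hi (cγ k) := by linarith [show x.γ k ≤ _ from (hb (cγ k)).2]
  have hu : N.u k ≠ 0 → (redW N b.lo * δ - redU N b) / N.u k ≤
      lg (1 + x.γ k) - lg (1 + b.hi (cγ k)) := fun hu => by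
    rw [div_le_iff₀' (lt_of_le_of_ne (N.u_nonneg k) (Ne.symm hu))]
    exact gap_γ hx hb hδ hobj k
  unfold redγ
  simp only
  split_ifs with h1 h2 h2 <;> rw [sub_le_iff_le_add']
  · exact rpow_mul_le hγ' hγ (redV_le_of_need_pos hx hb h1)
  · exact rpow_mul_le hγ' hγ (max_le (hu h2) (redV_le_of_need_pos hx hb h1))
  · exact rpow_le hγ (redV_add_le hx hb h1)
  · exact max_le (rpow_mul_le hγ' hγ (hu h2)) (rpow_le hγ (redV_add_le hx hb h1))

lemma redS_le (hx : Feasible N x) (hb : b.Mem (coords x.γ x.s α)) (hδ : 0 ≤ δ)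
    (hobj : δ ≤ objective N x) : redS N δ b ≤ x.s := by
  have hs : 0 < 1 + x.s := by linarith [hx.2.2.2.2.1]
  have hs' : 0 < 1 + b.hi cs := by linarith [show x.s ≤ _ from (hb cs).2]
  unfold redS
  rw [sub_le_iff_le_add']
  refine rpow_mul_le hs' hs (max_le ?_ (redV_le hx hb))
  rw [div_le_iff₀' (iSup_u_pos N)]
  exact gap_s hx hb hδ hobj

lemma redLo_le (hx : Feasible N x) (hb : b.Mem (coords x.γ x.s α)) (hδ : 0 ≤ δ)
    (hobj : δ ≤ objective N x) (i : Coord K) : redLo N δ b i ≤ coords x.γ x.s α i := by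
  rcases i with k | _ | k
  · exact max_le (hb (cγ k)).1 (redγ_le hx hb hδ hobj k)
  · exact max_le (hb cs).1 (redS_le hx hb hδ hobj)
  · exact (hb (cα k)).1

/-- The reduction only removes points that are infeasible or worse than `δ`. -/
lemma mem_reduce (hx : Feasible N x) (hb : b.Mem (coords x.γ x.s α)) (hδ : 0 ≤ δ)
    (hobj : δ ≤ objective N x) : (reduce N δ b).Mem (coords x.γ x.s α) := by
  have hlo := redLo_le hx hb hδ hobj
  refine fun i => ⟨hlo i, ?_⟩
  change _ ≤ redHi N δ b i
  unfold redHi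
  split_ifs with h0
  · exact (hb i).2
  have hpos : 0 < δ * N.μ := lt_of_le_of_ne (mul_nonneg hδ N.μ_nonneg) (Ne.symm h0)
  have h1 : δ * redW N (coords x.γ x.s α) ≤ redU N b := by
    refine (mul_redW_le hx α hδ hobj).trans ?_
    unfold redU
    have := N.u_nonneg
    exact add_le_add (mul_le_mul_of_nonneg_left (lg_s_le hx hb) (iSup_u_pos N).le)
      (Finset.sum_le_sum fun k _ => mul_le_mul_of_nonneg_left (lg_γ_le hx hb k) (this k))
  have hsup : ∀ k, (‖N.h k‖ ^ 2)⁻¹ ≤ ⨆ k, (‖N.h k‖ ^ 2)⁻¹ :=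
    fun k => le_ciSup (Finite.bddAbove_range fun k => (‖N.h k‖ ^ 2)⁻¹) k
  set v := coords x.γ x.s α with hv
  have hdiff : redW N v - redW N (redLo N δ b) =
      N.μ * ((v cs - redLo N δ b cs) * (⨆ k, (‖N.h k‖ ^ 2)⁻¹) +
        ∑ k, (v (cγ k) - redLo N δ b (cγ k)) * (‖N.h k‖ ^ 2)⁻¹) := by
    unfold redW
    simp only [sub_mul, Finset.sum_sub_distrib]
    ring
  have hs0 : 0 ≤ (v cs - redLo N δ b cs) := sub_nonneg.2 (hlo _)
  have hγ0 : ∀ k, 0 ≤ (v (cγ k) - redLo N δ b (cγ k)) * (‖N.h k‖ ^ 2)⁻¹ :=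
    fun k => mul_nonneg (sub_nonneg.2 (hlo _)) (by positivity)
  -- `W` is affine, so the excess of the point over the new lower corner costs at most the remaining
  -- budget `U - δ W'`. All summands are nonnegative, hence each coordinate alone obeys this; `a` is
  -- its excess and `μ / H` bounds its price from below.
  have hkey : ∀ a H : ℝ, 0 < H → a * H⁻¹ ≤ (v cs - redLo N δ b cs) * (⨆ k, (‖N.h k‖ ^ 2)⁻¹) +
        ∑ k, (v (cγ k) - redLo N δ b (cγ k)) * (‖N.h k‖ ^ 2)⁻¹ →
      a ≤ (δ * N.μ)⁻¹ * H * (redU N b - δ * redW N (redLo N δ b)) := fun a H hH ha => by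
    have h2 := mul_le_mul_of_nonneg_left ha hpos.le
    have h3 : δ * N.μ * (a * H⁻¹) ≤ redU N b - δ * redW N (redLo N δ b) := by
      refine h2.trans ?_
      rw [mul_assoc, ← hdiff]
      linarith
    calc a = (δ * N.μ)⁻¹ * H * (δ * N.μ * (a * H⁻¹)) := by
          rw [show (δ * N.μ)⁻¹ * H * (δ * N.μ * (a * H⁻¹)) =
            ((δ * N.μ)⁻¹ * (δ * N.μ)) * (H * H⁻¹) * a by ring, inv_mul_cancel₀ h0,
            mul_inv_cancel₀ hH.ne', one_mul, one_mul]
      _ ≤ _ := by gcongr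
  rcases i with k | _ | k
  · refine le_min (hb (cγ k)).2 (sub_le_iff_le_add'.1 (hkey _ _ (pow_pos (norm_h_pos N k) 2) ?_))
    refine le_add_of_nonneg_of_le (mul_nonneg hs0 (Real.iSup_nonneg fun k => by positivity)) ?_
    exact Finset.single_le_sum (fun k _ => hγ0 k) (Finset.mem_univ k)
  · obtain ⟨k, hk⟩ := exists_eq_ciInf_of_finite (f := fun k => ‖N.h k‖ ^ 2)
    refine le_min (hb cs).2 (sub_le_iff_le_add'.1 (hkey _ _ ?_ ?_))
    · rw [← hk]
      exact pow_pos (norm_h_pos N k) 2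
    · refine le_add_of_le_of_nonneg ?_ (Finset.sum_nonneg fun k _ => hγ0 k)
      rw [← hk]
      exact mul_le_mul_of_nonneg_left (hsup k) hs0
  · exact (hb (cα k)).2

lemma EssentialFeasible.feasible {ε : ℝ} (hε : 0 ≤ ε) (hx : EssentialFeasible N ε x) :
    Feasible N x := by
  obtain ⟨h1, h2, h3, h4, h5, h6, ⟨h7, h8, h9⟩, h10⟩ := hx
  refine ⟨h1, h2, h3, h4, h5, h6, ⟨fun k => ?_, ?_, fun k => ?_⟩, fun k => ?_⟩
  · linarith [h7 k]
  · linarith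
  · linarith [h9 k]
  · have := h10 k
    simp only [circleSet, Set.mem_ofPred_eq] at this ⊢
    linarith

/-- Boxes that contain an essential feasible point of value at least `δ` are not pruned. -/
lemma bound_le_of_mem {ε : ℝ} (hε : 0 ≤ ε) (hx : EssentialFeasible N ε x)
    (hα : ∀ k, IsAngle (x.e k) (α k)) (hlo : ∀ i, 0 ≤ b.lo i)
    (hb : b.Mem (coords x.γ x.s α)) (hobj : δ ≤ objective N x) :
    bound N δ b ≤ ((-ε : ℝ) : EReal) := by
  have hf := hx.feasible hε
  obtain ⟨h1, h2, h3, h4, h5, h6, ⟨h7, h8, h9⟩, h10⟩ := hx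
  have hγ := fun k => hb (cγ k)
  have hs := hb cs
  refine sInf_le ⟨⟨x.beam, x.c, fun k => lg (1 + x.γ k), lg (1 + x.s), x.d, x.e⟩, -ε,
    ⟨fun i => (hb i).1.trans (hb i).2, h1, h2, h3, (le_objective_iff N).1 hobj, h6,
      ⟨lg_mono (by linarith [hlo cs]) (by linarith [show _ ≤ x.s from hs.1]), lg_s_le hf hb⟩,
      fun k => ⟨lg_mono (by linarith [hlo (cγ k)]) (by linarith [show _ ≤ x.γ k from (hγ k).1]),
        lg_γ_le hf hb k⟩, ⟨fun k => ?_, ?_, fun k => ?_⟩, fun k hk => ?_⟩, rfl⟩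
  · exact (mul_le_mul_of_nonneg_right (Real.sqrt_le_sqrt (hγ k).1) (Real.sqrt_nonneg _)).trans (h7 k)
  · exact (mul_le_mul_of_nonneg_right (Real.sqrt_le_sqrt hs.1) (Real.sqrt_nonneg _)).trans h8
  · exact (mul_le_mul_of_nonneg_right (Real.sqrt_le_sqrt hs.1) (Real.sqrt_nonneg _)).trans (h9 k)
  · exact argCut_of_isAngle hk (hb (cα k)) (hα k) (h10 k)

lemma exists_mem_half {b : Box K} {v : Coord K → ℝ} (hb : b.Mem v) (j : Coord K) :
    ∃ i, (half b j i).Mem v := by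
  rcases le_total (v j) ((b.lo j + b.hi j) / 2) with h | h
  · refine ⟨false, fun i => ⟨(hb i).1, ?_⟩⟩
    by_cases hij : i = j
    · subst hij; simpa [half] using h
    · simpa [half, hij] using (hb i).2
  · refine ⟨true, fun i => ⟨?_, (hb i).2⟩⟩
    by_cases hij : i = j
    · subst hij; simpa [half] using h
    · simpa [half, hij] using (hb i).1

end Reduction

/-! ### Attainment of minima and solvability of the feasible point step. -/

section Closedness

variable {M K : ℕ} (N : Network M K)

lemma isClosed_and {X : Type*} [TopologicalSpace X] {p r : X → Prop} (hp : IsClosed {q | p q})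
    (hr : IsClosed {q | r q}) : IsClosed {q | p q ∧ r q} := hp.inter hr

lemma isClosed_all {X : Type*} {ι : Sort*} [TopologicalSpace X] {p : ι → X → Prop}
    (hp : ∀ i, IsClosed {q | p i q}) : IsClosed {q | ∀ i, p i q} := by
  rw [show {q | ∀ i, p i q} = ⋂ i, {q | p i q} by ext; simp]
  exact isClosed_iInter hp

lemma continuous_rx (k : Fin K) : Continuous (rx N k) := by
  unfold rx; fun_prop

lemma isClosed_rateOK {X : Type*} [TopologicalSpace X] {c ρ : X → Fin K → ℝ} {σ : X → ℝ}
    (hc : Continuous c) (hρ : Continuous ρ) (hσ : Continuous σ) :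
    IsClosed {q | RateOK N (c q) (ρ q) (σ q)} := by
  refine isClosed_and (isClosed_le (by fun_prop) (by fun_prop)) (isClosed_all fun k => ?_)
  exact isClosed_le (by fun_prop) (by fun_prop)

lemma power_le_of_norm_pc_le {y : Beam M K} {p : EuclideanSpace ℂ (Fin M)} (hp : ‖p‖ ≤ ‖y.pc‖) :
    power ⟨p, y.pp⟩ ≤ power y := by
  unfold power
  gcongr

end Closedness

section Existence

variable {M K : ℕ} [NeZero K]

/-- Optimization variables of the bounding and the test problem without the auxiliary `d`, `e`:
beamformers, common rates, SINR levels (or rates) and the objective value `t`. -/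
abbrev Vars (M K : ℕ) := EuclideanSpace ℂ (Fin M) × (Fin K → EuclideanSpace ℂ (Fin M)) ×
  (Fin K → ℝ) × (Fin K → ℝ) × ℝ × ℝ

/-- The tuple of variables with the smallest `d` that is feasible for the common SINR level `s₀`. -/
noncomputable def toPoint (N : Network M K) (s₀ : ℝ) (q : Vars M K) : Point M K where
  beam := ⟨q.1, q.2.1⟩
  c := q.2.2.1
  γ := q.2.2.2.1
  s := q.2.2.2.2.1
  d := fun k => max 0 (√s₀ * √(noiseC N ⟨q.1, q.2.1⟩ k) - q.2.2.2.2.2)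
  e := fun k => rx N k q.1

/-- Forget `d` and `e`. -/
def toVars (x : Point M K) (t : ℝ) : Vars M K := (x.beam.pc, x.beam.pp, x.c, x.γ, x.s, t)

variable (N : Network M K)

lemma continuous_noiseC (s₀ : ℝ) (k : Fin K) :
    Continuous fun q : Vars M K => noiseC N (toPoint N s₀ q).beam k := by
  have := continuous_rx N k
  simp only [noiseC, toPoint]
  fun_prop

lemma continuous_noiseP (s₀ : ℝ) (k : Fin K) :
    Continuous fun q : Vars M K => noiseP N (toPoint N s₀ q).beam k := by
  have := continuous_rx N k
  simp only [noiseP, toPoint]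
  fun_prop

lemma continuous_power (s₀ : ℝ) :
    Continuous fun q : Vars M K => power (toPoint N s₀ q).beam := by
  simp only [power, toPoint]
  fun_prop

lemma continuous_d (s₀ : ℝ) (k : Others K) :
    Continuous fun q : Vars M K => (toPoint N s₀ q).d k := by
  have : Continuous fun q : Vars M K => noiseC N ⟨q.1, q.2.1⟩ k := continuous_noiseC N s₀ k
  simp only [toPoint]
  fun_prop

lemma isClosed_phaseOK (s₀ : ℝ) : IsClosed {q : Vars M K | PhaseOK N (toPoint N s₀ q).beam} := by
  have h := continuous_rx N
  have h0 := continuous_rx N 0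
  simp only [PhaseOK, toPoint]
  refine isClosed_and (isClosed_all fun k => ?_) (isClosed_and ?_ ?_)
  · have := h k
    exact isClosed_and (isClosed_le (by fun_prop) (by fun_prop))
      (isClosed_eq (by fun_prop) (by fun_prop))
  · exact isClosed_le (by fun_prop) (by fun_prop)
  · exact isClosed_eq (by fun_prop) (by fun_prop)

lemma auxOK_toPoint (s₀ : ℝ) (q : Vars M K) : AuxOK N (toPoint N s₀ q) :=
  fun _ => ⟨le_max_left _ _, rfl⟩

lemma isClosed_socOK (s₀ : ℝ) (γ : Fin K → ℝ) (s : ℝ) :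
    IsClosed {q : Vars M K | SocOK N (toPoint N s₀ q).beam (toPoint N s₀ q).d γ s q.2.2.2.2.2} := by
  have h := continuous_rx N
  have h0 := continuous_rx N 0
  refine isClosed_and (isClosed_all fun k => ?_) (isClosed_and ?_ (isClosed_all fun k => ?_))
  · have := h k
    have := continuous_noiseP N s₀ k
    refine isClosed_le (by fun_prop) ?_
    simp only [toPoint]
    fun_prop
  · have := continuous_noiseC N s₀ 0
    refine isClosed_le (by fun_prop) ?_
    simp only [toPoint]
    fun_prop
  · have := continuous_noiseC N s₀ k
    have := continuous_d N s₀ k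
    exact isClosed_le (by fun_prop) (by fun_prop)

/-- Attainment of the minimum of `t` over a set that is closed and bounded up to the choice
of `d`. -/
lemma exists_minimizer (s₀ : ℝ) {Q : Point M K → ℝ → Prop}
    (hcl : IsClosed {q : Vars M K | Q (toPoint N s₀ q) q.2.2.2.2.2})
    (hnorm : ∀ x t, Q x t → Q (toPoint N s₀ (toVars x t)) t)
    {c₁ c₂ γ₁ γ₂ : Fin K → ℝ} {s₁ s₂ T : ℝ}
    (hbd : ∀ x t, Q x t → power x.beam ≤ N.P ∧ x.c ∈ Set.Icc c₁ c₂ ∧ x.γ ∈ Set.Icc γ₁ γ₂ ∧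
      x.s ∈ Set.Icc s₁ s₂ ∧ T ≤ t)
    (hne : ∃ x t, Q x t) : ∃ x t, Q x t ∧ ∀ x' t', Q x' t' → t ≤ t' := by
  obtain ⟨x₀, t₀, h₀⟩ := hne
  -- Passing to a sublevel set bounds `t` from above without changing the minimum.
  let S : Set (Vars M K) := {q | Q (toPoint N s₀ q) q.2.2.2.2.2 ∧ q.2.2.2.2.2 ≤ t₀}
  have hS : IsClosed S := isClosed_and hcl (isClosed_le (by fun_prop) (by fun_prop))
  have hcomp : IsCompact S := by
    refine IsCompact.of_isClosed_subset
      ((isCompact_closedBall (0 : EuclideanSpace ℂ (Fin M)) √N.P).prod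
      ((isCompact_closedBall (0 : Fin K → EuclideanSpace ℂ (Fin M)) √N.P).prod
      ((isCompact_Icc (a := c₁) (b := c₂)).prod ((isCompact_Icc (a := γ₁) (b := γ₂)).prod
      ((isCompact_Icc (a := s₁) (b := s₂)).prod (isCompact_Icc (a := T) (b := t₀))))))) hS ?_
    rintro q ⟨hq, hq'⟩
    obtain ⟨h1, h2, h3, h4, h5⟩ := hbd (toPoint N s₀ q) q.2.2.2.2.2 hq
    simp only [Set.mem_prod]
    refine ⟨?_, ?_, h2, h3, h4, ⟨h5, hq'⟩⟩
    · rw [mem_closedBall_zero_iff]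
      exact Real.le_sqrt_of_sq_le ((norm_pc_sq_le_power (toPoint N s₀ q).beam).trans h1)
    · rw [mem_closedBall_zero_iff, pi_norm_le_iff_of_nonneg (Real.sqrt_nonneg _)]
      exact fun k => Real.le_sqrt_of_sq_le ((norm_pp_sq_le_power (toPoint N s₀ q).beam k).trans h1)
  obtain ⟨q, hq, hmin⟩ := hcomp.exists_isMinOn (f := fun q => q.2.2.2.2.2)
    ⟨toVars x₀ t₀, hnorm _ _ h₀, le_rfl⟩ (by fun_prop)
  refine ⟨_, _, hq.1, fun x t hx => ?_⟩
  by_cases ht : t ≤ t₀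
  · exact hmin (show toVars x t ∈ S from ⟨hnorm _ _ hx, ht⟩)
  · exact hq.2.trans (le_of_not_ge ht)

variable {N}

/-- The cone constraint of the first user bounds `t` below, as its gain is bounded by the power
budget. -/
lemma SocOK.neg_gainBound_le {y : Beam M K} {d : Others K → ℝ} {γ : Fin K → ℝ} {s t : ℝ}
    (h : SocOK N y d γ s t) (hy : power y ≤ N.P) : -gainBound N ≤ t := by
  have h1 := h.2.1
  have h2 := (Complex.re_le_norm _).trans
    (norm_rx_le_gainBound N 0 y.pc ((norm_pc_sq_le_power y).trans hy))
  have h3 : 0 ≤ √s * √(noiseC N y 0) := by positivity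
  linarith

/-- Decreasing `d` to its smallest feasible value keeps the SOC constraints. -/
lemma SocOK.toPoint {x : Point M K} {γ : Fin K → ℝ} {s t : ℝ} (h : SocOK N x.beam x.d γ s t) :
    SocOK N (toPoint N s (toVars x t)).beam (toPoint N s (toVars x t)).d γ s t := by
  refine ⟨h.1, h.2.1, fun k => ?_⟩
  have := le_max_right 0 (√s * √(noiseC N x.beam k) - t)
  change √s * √(noiseC N x.beam k) ≤ t + max 0 (√s * √(noiseC N x.beam k) - t)
  linarith

lemma toPoint_d_le {x : Point M K} {γ : Fin K → ℝ} {s t : ℝ} (h : SocOK N x.beam x.d γ s t)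
    (hx : AuxOK N x) (k : Others K) : (toPoint N s (toVars x t)).d k ≤ x.d k :=
  max_le (hx k).1 (sub_le_iff_le_add'.2 (h.2.2 k))

lemma exists_bnd_minimizer {δ : ℝ} {b : Box K} (hne : ∃ x t, BndFeasible N δ b x t) :
    ∃ x t, BndFeasible N δ b x t ∧ ∀ x' t', BndFeasible N δ b x' t' → t ≤ t' := by
  -- The level that fixes the least `d` is the lower bound `b.lo cs`, not the variable `x.s`, which
  -- is a rate here.
  refine exists_minimizer N (b.lo cs) (c₁ := 0) (c₂ := fun _ => lg (1 + b.hi cs))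
    (γ₁ := fun k => lg (1 + b.lo (cγ k))) (γ₂ := fun k => lg (1 + b.hi (cγ k)))
    (s₁ := lg (1 + b.lo cs)) (s₂ := lg (1 + b.hi cs)) (T := -gainBound N) ?_ ?_ ?_ hne
  · have hp := continuous_power N (b.lo cs)
    refine isClosed_and isClosed_const (isClosed_and (isClosed_phaseOK N _) (isClosed_and ?_
      (isClosed_and (isClosed_le hp continuous_const) (isClosed_and ?_ (isClosed_and
      (isClosed_rateOK N ?_ ?_ ?_) (isClosed_and ?_ (isClosed_and (isClosed_all fun k => ?_)
      (isClosed_and (isClosed_socOK N _ _ _) (isClosed_all fun k =>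
        isClosed_all fun hk => ?_)))))))))
    · simp [auxOK_toPoint]
    · refine isClosed_le (by fun_prop) ?_
      simp only [toPoint]
      fun_prop
    · simp only [toPoint]; fun_prop
    · simp only [toPoint]; fun_prop
    · simp only [toPoint]; fun_prop
    · exact isClosed_Icc.preimage (f := fun q : Vars M K => (toPoint N (b.lo cs) q).s)
        (by simp only [toPoint]; fun_prop)
    · exact isClosed_Icc.preimage (f := fun q : Vars M K => (toPoint N (b.lo cs) q).γ k)
        (by simp only [toPoint]; fun_prop)
    · have he : Continuous fun q : Vars M K => (toPoint N (b.lo cs) q).e k := by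
        have := continuous_rx N k
        simp only [toPoint]
        fun_prop
      have hd := continuous_d N (b.lo cs) k
      exact isClosed_and (isClosed_le (by fun_prop) (by fun_prop)) (isClosed_and
        (isClosed_le (by fun_prop) (by fun_prop)) (isClosed_le (by fun_prop) (by fun_prop)))
  · rintro x t ⟨h1, h2, h3, h4, h5, h6, h7, h8, h9, h10⟩
    refine ⟨h1, h2, auxOK_toPoint N _ _, h4, h5, h6, h7, h8, h9.toPoint, fun k hk => ?_⟩
    have := (h10 k hk).mono (sub_le_sub_right (toPoint_d_le h9 h3 k) t)
    rwa [(h3 k).2] at this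
  · rintro x t ⟨h1, h2, h3, h4, h5, h6, h7, h8, h9, h10⟩
    exact ⟨h4, ⟨h6.nonneg N, fun k => (h6.le N k).trans h7.2⟩,
      ⟨fun k => (h8 k).1, fun k => (h8 k).2⟩, h7, h9.neg_gainBound_le h4⟩

/-- A bound below `∞` is attained. -/
lemma exists_eq_bound {δ : ℝ} {b : Box K} (h : bound N δ b < ⊤) :
    ∃ x t, BndFeasible N δ b x t ∧ (t : EReal) = bound N δ b := by
  have hne : ∃ x t, BndFeasible N δ b x t := by
    by_contra! hc
    have : bound N δ b = ⊤ := by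
      unfold bound
      rw [show {r : EReal | ∃ (x : Point M K) (t : ℝ), BndFeasible N δ b x t ∧ r = (t : EReal)} = ∅
        by ext; simp [hc], sInf_empty]
    exact h.ne this
  obtain ⟨x, t, hx, hmin⟩ := exists_bnd_minimizer hne
  refine ⟨x, t, hx, le_antisymm (le_sInf ?_) (sInf_le ⟨x, t, hx, rfl⟩)⟩
  rintro _ ⟨x', t', hx', rfl⟩
  exact_mod_cast hmin x' t' hx'

lemma exists_test_minimizer {δ : ℝ} {γ : Fin K → ℝ} {s : ℝ} {α : Others K → ℝ}
    (hne : ∃ x t, TestFeasible N δ γ s α x t) :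
    ∃ x t, TestFeasible N δ γ s α x t ∧ ∀ x' t', TestFeasible N δ γ s α x' t' → t ≤ t' := by
  refine exists_minimizer N s (c₁ := 0) (c₂ := fun _ => lg (1 + s)) (γ₁ := γ) (γ₂ := γ)
    (s₁ := s) (s₂ := s) (T := -gainBound N) ?_ ?_ ?_ hne
  · have hp := continuous_power N s
    -- The levels are fixed, so the logarithms can be made constants. Continuity of `lg`, which
    -- fails at zero, is then not needed, and the quotient in the objective is cleared.
    have heq : {q : Vars M K | TestFeasible N δ γ s α (toPoint N s q) q.2.2.2.2.2} =
        {q | (toPoint N s q).γ = γ ∧ (toPoint N s q).s = s ∧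
          δ * (N.μ * power (toPoint N s q).beam + N.Pc) ≤
            ∑ k, N.u k * ((toPoint N s q).c k + lg (1 + γ k)) ∧
          PhaseOK N (toPoint N s q).beam ∧ AuxOK N (toPoint N s q) ∧
          power (toPoint N s q).beam ≤ N.P ∧
          RateOK N (toPoint N s q).c (fun k => lg (1 + γ k)) (lg (1 + s)) ∧
          SocOK N (toPoint N s q).beam (toPoint N s q).d γ s q.2.2.2.2.2 ∧
          ∀ k, (toPoint N s q).d k - q.2.2.2.2.2 ≤ ‖(toPoint N s q).e k‖ ∧
            IsAngle ((toPoint N s q).e k) (α k)} := by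
      ext q
      constructor
      · rintro ⟨h1, h2, h3, h4, h5, h6, h7, h8, h9⟩
        rw [le_objective_iff, h1] at h3
        rw [h1, h2] at h7
        exact ⟨h1, h2, h3, h4, h5, h6, h7, h8, h9⟩
      · rintro ⟨h1, h2, h3, h4, h5, h6, h7, h8, h9⟩
        rw [← h1] at h3
        refine ⟨h1, h2, (le_objective_iff N).2 h3, h4, h5, h6, ?_, h8, h9⟩
        rwa [h1, h2]
    rw [heq]
    refine isClosed_and (isClosed_eq ?_ continuous_const) (isClosed_and
      (isClosed_eq ?_ continuous_const) (isClosed_and ?_ (isClosed_and (isClosed_phaseOK N _)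
      (isClosed_and ?_ (isClosed_and (isClosed_le hp continuous_const) (isClosed_and
      (isClosed_rateOK N ?_ continuous_const continuous_const) (isClosed_and
      (isClosed_socOK N _ _ _) (isClosed_all fun k => ?_))))))))
    · simp only [toPoint]; fun_prop
    · simp only [toPoint]; fun_prop
    · refine isClosed_le (by fun_prop) ?_
      simp only [toPoint]
      fun_prop
    · simp [auxOK_toPoint]
    · simp only [toPoint]; fun_prop
    · have he : Continuous fun q : Vars M K => (toPoint N s q).e k := by
        have := continuous_rx N k
        simp only [toPoint]
        fun_prop
      have hd := continuous_d N s k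
      refine isClosed_and (isClosed_le (by fun_prop) (by fun_prop)) ?_
      unfold IsAngle
      exact isClosed_eq (by fun_prop) (by fun_prop)
  · rintro x t ⟨h1, h2, h3, h4, h5, h6, h7, h8, h9⟩
    refine ⟨h1, h2, h3, h4, auxOK_toPoint N _ _, h6, h7, h8.toPoint, fun k => ?_⟩
    have h := h9 k
    rw [(h5 k).2] at h
    exact ⟨(sub_le_sub_right (toPoint_d_le h8 h5 k) t).trans h.1, h.2⟩
  · rintro x t ⟨h1, h2, h3, h4, h5, h6, h7, h8, h9⟩
    rw [h1, h2] at h7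
    exact ⟨h6, ⟨h7.nonneg N, h7.le N⟩, ⟨h1.ge, h1.le⟩, ⟨h2.ge, h2.le⟩, h8.neg_gainBound_le h6⟩

lemma exists_bestRates {δ : ℝ} {y : Beam M K} {c : Fin K → ℝ} (hc : RatesFor N y c)
    (hδ : δ ≤ objective N (recover N y c)) : ∃ c, BestRates N δ y c := by
  let S : Set (Fin K → ℝ) := {c | RatesFor N y c ∧ δ ≤ objective N (recover N y c)}
  have hS : IsClosed S := by
    refine isClosed_and (isClosed_rateOK N continuous_id continuous_const continuous_const) ?_
    simp only [objective, recover]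
    exact isClosed_le (by fun_prop) (by fun_prop)
  have hcomp : IsCompact S := (isCompact_Icc (a := (0 : Fin K → ℝ))
    (b := fun _ => lg (1 + ⨅ k, sinrC N y k))).of_isClosed_subset hS
    fun c hc => ⟨RateOK.nonneg N hc.1, RateOK.le N hc.1⟩
  obtain ⟨c', hc', hmax⟩ := hcomp.exists_isMaxOn (f := fun c => ∑ k, N.u k * c k)
    ⟨c, hc, hδ⟩ (by fun_prop)
  exact ⟨c', hc', fun c'' h1 h2 => hmax (show c'' ∈ S from ⟨h1, h2⟩)⟩

/-- Solutions of the test problem with `τ ≤ 0` yield beamformers with admissible rates. -/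
lemma TestFeasible.ratesFor {δ : ℝ} {γ : Fin K → ℝ} {s : ℝ} {α : Others K → ℝ} {z : Point M K}
    {τ : ℝ} (hz : TestFeasible N δ γ s α z τ) (hγ : ∀ k, 0 ≤ γ k) (hs : 0 ≤ s) (hτ : τ ≤ 0) :
    RatesFor N z.beam z.c ∧ δ ≤ objective N (recover N z.beam z.c) := by
  obtain ⟨h1, h2, h3, h4, h5, h6, h7, h8, h9⟩ := hz
  obtain ⟨hP, hC⟩ := le_sinr_of_soc N h4 hγ hs hτ h8 fun k => by
    rw [← (h5 k).2]
    exact (h9 k).1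
  rw [h1, h2] at h7
  have hP' : ∀ k, lg (1 + γ k) ≤ lg (1 + sinrP N z.beam k) := fun k =>
    lg_mono (by linarith [hγ k]) (by linarith [hP k])
  refine ⟨h7.mono N hP' (lg_mono (by linarith) (by linarith [le_ciInf hC])), ?_⟩
  rw [le_objective_iff, h1] at h3
  rw [le_objective_iff]
  refine h3.trans (Finset.sum_le_sum fun k _ => mul_le_mul_of_nonneg_left ?_ (N.u_nonneg k))
  exact add_le_add le_rfl (hP' k)

/-- Points of the test problem that are obtained from the bounding problem by replacing the common
beamformer. -/
lemma BndFeasible.testFeasible {δ : ℝ} {b : Box K} {x : Point M K} {t : ℝ}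
    (hx : BndFeasible N δ b x t) (hδ : 0 ≤ δ) {p : EuclideanSpace ℂ (Fin M)}
    (hp : ‖p‖ ≤ ‖x.beam.pc‖) (h0 : 0 ≤ (rx N 0 p).re ∧ (rx N 0 p).im = 0) {α d : Others K → ℝ}
    (hα : ∀ k : Others K, IsAngle (rx N k p) (α k)) {τ : ℝ} (hd : ∀ k, 0 ≤ d k)
    (hd' : ∀ k : Others K, d k - τ ≤ ‖rx N k p‖)
    (hsoc : SocOK N ⟨p, x.beam.pp⟩ d (fun k => (2 : ℝ) ^ x.γ k - 1) ((2 : ℝ) ^ x.s - 1) τ) :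
    ∃ z, TestFeasible N δ (fun k => (2 : ℝ) ^ x.γ k - 1) ((2 : ℝ) ^ x.s - 1) α z τ := by
  obtain ⟨-, h2, -, h4, h5, h6, -⟩ := hx
  have hpow := power_le_of_norm_pc_le (y := x.beam) hp
  refine ⟨⟨⟨p, x.beam.pp⟩, x.c, fun k => (2 : ℝ) ^ x.γ k - 1, (2 : ℝ) ^ x.s - 1, d,
    fun k => rx N k p⟩, rfl, rfl, ?_, ⟨h2.1, h0⟩, fun k => ⟨hd k, rfl⟩, hpow.trans h4, ?_, hsoc,
    fun k => ⟨hd' k, hα k⟩⟩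
  · rw [le_objective_iff]
    simp only [lg_rpow]
    refine le_trans (mul_le_mul_of_nonneg_left ?_ hδ) h5
    have := mul_le_mul_of_nonneg_left hpow N.μ_nonneg
    linarith
  · simp only [lg_rpow]
    exact h6

/-- A zero common beamformer meets every angle condition and only saves power; `t` is the sum of all
left sides of the cone constraints. -/
lemma BndFeasible.exists_test {δ : ℝ} {b : Box K} {x : Point M K} {t : ℝ}
    (hx : BndFeasible N δ b x t) (hδ : 0 ≤ δ) (α : Others K → ℝ) :
    ∃ z τ, TestFeasible N δ (fun k => (2 : ℝ) ^ x.γ k - 1) ((2 : ℝ) ^ x.s - 1) α z τ := by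
  have hrx : ∀ k, rx N k 0 = 0 := fun k => by simp [rx]
  let y : Beam M K := ⟨0, x.beam.pp⟩
  let T : ℝ := ∑ k, (√((2 : ℝ) ^ x.γ k - 1) * √(noiseP N y k) +
    √((2 : ℝ) ^ x.s - 1) * √(noiseC N y k))
  have hT : ∀ k, √((2 : ℝ) ^ x.γ k - 1) * √(noiseP N y k) +
      √((2 : ℝ) ^ x.s - 1) * √(noiseC N y k) ≤ T := fun k =>
    Finset.single_le_sum (f := fun k => √((2 : ℝ) ^ x.γ k - 1) * √(noiseP N y k) +
      √((2 : ℝ) ^ x.s - 1) * √(noiseC N y k)) (fun i _ => by positivity) (Finset.mem_univ k)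
  have h1 : ∀ k, 0 ≤ √((2 : ℝ) ^ x.γ k - 1) * √(noiseP N y k) := fun k => by positivity
  have h2 : ∀ k, 0 ≤ √((2 : ℝ) ^ x.s - 1) * √(noiseC N y k) := fun k => by positivity
  obtain ⟨z, hz⟩ := hx.testFeasible hδ (p := 0) (by simp) (by simp [hrx]) (α := α) (d := 0)
    (τ := T) (fun k => by rw [hrx]; exact isAngle_zero _) (fun k => le_rfl)
    (fun k => by
      rw [hrx, norm_zero, Pi.zero_apply, sub_nonpos]
      linarith [hT 0, h1 0, h2 0])
    ⟨fun k => by linarith [hT k, h2 k, (hx.2.1.1 k).1],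
      by rw [hrx, Complex.zero_re]; linarith [hT 0, h1 0],
      fun k => by rw [Pi.zero_apply]; linarith [hT k, h1 k]⟩
  exact ⟨z, T, hz⟩

/-- The angle intervals that occur in the algorithm: all of `[0, 2π]` or of length at most `π`. -/
def AngleOK (b : Box K) : Prop := ∀ k : Others K, b.lo (cα k) < b.hi (cα k) ∧
  (b.hi (cα k) - b.lo (cα k) ≤ Real.pi ∨ (b.lo (cα k) = 0 ∧ b.hi (cα k) = 2 * Real.pi))

/-- This is what makes the argument rule executable: either the cut is active and confines `e_k` to
the sector, or the interval is the full circle. -/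
lemma BndFeasible.exists_isAngle {δ : ℝ} {b : Box K} {x : Point M K} {t : ℝ}
    (hx : BndFeasible N δ b x t) (hb : AngleOK b) (k : Others K) :
    ∃ φ ∈ Set.Icc (b.lo (cα k)) (b.hi (cα k)), IsAngle (x.e k) φ := by
  rcases (hb k).2 with h | ⟨h1, h2⟩
  · obtain ⟨h1, h2, -⟩ := hx.2.2.2.2.2.2.2.2.2 k h
    exact exists_isAngle_of_cut (hb k).1 h1 h2
  · rw [h1, h2]
    exact RSMA.exists_isAngle _

lemma exists_picks (rule : AngleRule) {l r : ℝ} {e : ℂ} (h : ∃ φ ∈ Set.Icc l r, IsAngle e φ) :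
    ∃ α, rule.Picks l r e α := by
  cases rule with
  | argument => exact h
  | endpoint =>
    obtain ⟨θ, hθ, hθ'⟩ := exists_isAngle e
    rcases le_total |l - θ| |r - θ| with h | h
    · exact ⟨l, θ, hθ, hθ', .inl rfl, le_rfl, h⟩
    · exact ⟨r, θ, hθ, hθ', .inr rfl, h, le_rfl⟩

lemma BndFeasible.rpow_mem {δ : ℝ} {b : Box K} {x : Point M K} {t : ℝ}
    (hx : BndFeasible N δ b x t) (hlo : ∀ i, 0 ≤ b.lo i) :
    (∀ k, (2 : ℝ) ^ x.γ k - 1 ∈ Set.Icc (b.lo (cγ k)) (b.hi (cγ k))) ∧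
      (2 : ℝ) ^ x.s - 1 ∈ Set.Icc (b.lo cs) (b.hi cs) := by
  have key : ∀ ρ l h : ℝ, 0 ≤ l → l ≤ h → ρ ∈ Set.Icc (lg (1 + l)) (lg (1 + h)) →
      (2 : ℝ) ^ ρ - 1 ∈ Set.Icc l h := by
    rintro ρ l h hl hlh ⟨h1, h2⟩
    have h3 := (Real.logb_le_iff_le_rpow one_lt_two (by linarith)).1 h1
    have h4 := (Real.le_logb_iff_rpow_le one_lt_two (by linarith)).1 h2
    constructor <;> linarith
  exact ⟨fun k => key _ _ _ (hlo _) (hx.1 _) (hx.2.2.2.2.2.2.2.1 k),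
    key _ _ _ (hlo _) (hx.1 _) hx.2.2.2.2.2.2.1⟩

lemma exists_feasPoint (rule : AngleRule) {δ : ℝ} (hδ : 0 ≤ δ) {b : Box K}
    (hlo : ∀ i, 0 ≤ b.lo i) (hb : AngleOK b) : ∃ o, FeasPoint N rule δ b o := by
  rcases lt_or_ge 0 (bound N δ b) with h | h
  · exact ⟨none, .inl ⟨h, rfl⟩⟩
  obtain ⟨x, t, hx, ht⟩ := exists_eq_bound (h.trans_lt EReal.zero_lt_top)
  choose α hα using fun k => exists_picks rule (hx.exists_isAngle hb k)
  obtain ⟨z, τ, hz, hmin⟩ := exists_test_minimizer (hx.exists_test hδ α)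
  rcases lt_or_ge 0 τ with hτ | hτ
  · exact ⟨none, .inr ⟨h, x, t, hx, ht, α, hα, z, τ, hz, hmin, .inl ⟨hτ, rfl⟩⟩⟩
  · obtain ⟨h1, h2⟩ := hx.rpow_mem hlo
    obtain ⟨h3, h4⟩ := hz.ratesFor (fun k => (hlo _).trans (h1 k).1) ((hlo _).trans h2.1) hτ
    obtain ⟨c, hc⟩ := exists_bestRates h3 h4
    exact ⟨_, .inr ⟨h, x, t, hx, ht, α, hα, z, τ, hz, hmin, .inr ⟨hτ, c, hc, rfl⟩⟩⟩

/-- Candidates are feasible and have value at least `δ`. -/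
lemma FeasPoint.feasible {rule : AngleRule} {δ : ℝ} {b : Box K} {o : Option (Point M K)}
    (h : FeasPoint N rule δ b o) {x : Point M K} (ho : o = some x) :
    Feasible N x ∧ δ ≤ objective N x := by
  rcases h with ⟨-, h⟩ | ⟨-, _, _, _, _, _, _, z, τ, hz, -, ⟨-, h⟩ | ⟨-, c, hc, h⟩⟩
  · simp [h] at ho
  · simp [h] at ho
  · rw [h, Option.some_inj] at ho
    subst ho
    obtain ⟨-, -, -, h4, -, h6, -⟩ := hz
    exact ⟨recover_feasible N h4 h6 hc.1.1, hc.1.2⟩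

end Existence

/-! ### Small boxes with bound at most `-ε` have candidates. -/

section SmallBoxes

variable {M K : ℕ} (N : Network M K)

/-- Linearly independent channels have a dual family of beamformers. -/
lemma exists_dual_beams (hli : LinearIndependent ℂ N.h) :
    ∃ g : Fin K → EuclideanSpace ℂ (Fin M), ∀ i j, rx N i (g j) = if i = j then 1 else 0 := by
  obtain ⟨F, hF⟩ := (Fintype.linearCombination ℂ N.h).exists_leftInverse_of_injective
    (LinearMap.ker_eq_bot.2 (hli.fintypeLinearCombination_injective))
  have hF' : ∀ i, F (N.h i) = Pi.single i 1 := fun i => by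
    have := LinearMap.congr_fun hF (Pi.single i 1)
    simpa [Fintype.linearCombination_apply_single] using this
  refine ⟨fun j => (InnerProductSpace.toDual ℂ _).symm
    (LinearMap.toContinuousLinearMap (LinearMap.proj j ∘ₗ F)), fun i j => ?_⟩
  unfold rx
  rw [← inner_conj_symm, InnerProductSpace.toDual_symm_apply]
  by_cases hij : i = j
  · subst hij
    simp [hF']
  · simp [hF', hij, Ne.symm hij]

/-- For `p ≠ 0`, scaling `p + q` by `r = ‖p‖ / (‖p‖ + ‖q‖)` restores the norm bound, and the scaling
moves the sum by at most `(1 - r) (‖p‖ + ‖q‖) = ‖q‖`. -/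
lemma exists_shrink {E : Type*} [NormedAddCommGroup E] [NormedSpace ℂ E] (p q : E) :
    ∃ r : ℝ, 0 ≤ r ∧ ‖(r : ℂ) • (p + q)‖ ≤ ‖p‖ ∧ ‖(r : ℂ) • (p + q) - p‖ ≤ 2 * ‖q‖ := by
  by_cases hp : p = 0
  · exact ⟨0, le_rfl, by simp, by simp [hp]⟩
  have hp' : 0 < ‖p‖ := norm_pos_iff.2 hp
  have hs : 0 < ‖p‖ + ‖q‖ := by positivity
  have hr : 0 ≤ ‖p‖ / (‖p‖ + ‖q‖) := by positivity
  have hr1 : ‖p‖ / (‖p‖ + ‖q‖) ≤ 1 := (div_le_one hs).2 (by linarith [norm_nonneg q])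
  have hmul : ‖p‖ / (‖p‖ + ‖q‖) * (‖p‖ + ‖q‖) = ‖p‖ := div_mul_cancel₀ _ hs.ne'
  set r := ‖p‖ / (‖p‖ + ‖q‖)
  have hn := norm_add_le p q
  refine ⟨r, hr, ?_, ?_⟩
  · rw [norm_smul, Complex.norm_real, Real.norm_eq_abs, abs_of_nonneg hr]
    exact (mul_le_mul_of_nonneg_left hn hr).trans hmul.le
  · have h1 : (r : ℂ) • (p + q) - p = q - ((1 - r : ℝ) : ℂ) • (p + q) := by
      push_cast
      module
    rw [h1]
    refine (norm_sub_le _ _).trans ?_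
    rw [norm_smul, Complex.norm_real, Real.norm_eq_abs, abs_of_nonneg (sub_nonneg.2 hr1)]
    have := mul_le_mul_of_nonneg_left hn (sub_nonneg.2 hr1)
    linarith

/-- Small changes of all gains, up to a common scaling, are possible without more power. -/
lemma exists_perturbation (hli : LinearIndependent ℂ N.h) {ε : ℝ} (hε : 0 < ε) :
    ∃ ω > 0, ∀ (p : EuclideanSpace ℂ (Fin M)) (v : Fin K → ℂ), (∀ k, ‖v k - rx N k p‖ ≤ ω) →
      ∃ (p' : EuclideanSpace ℂ (Fin M)) (r : ℝ), 0 ≤ r ∧ ‖p'‖ ≤ ‖p‖ ∧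
        (∀ k, rx N k p' = r * v k) ∧ ∀ k, ‖rx N k p' - rx N k p‖ ≤ ε := by
  obtain ⟨g, hg⟩ := exists_dual_beams N hli
  set G := ∑ k, ‖g k‖
  set H := ∑ k, ‖N.h k‖
  have hG : 0 ≤ G := by positivity
  have hH : 0 ≤ H := by positivity
  have hC : 0 < 2 * H * G + 1 := by positivity
  -- The correction `q` built from the dual family has norm at most `ω G`, so after shrinking each
  -- gain moves by at most `2 H G ω`.
  refine ⟨ε / (2 * H * G + 1), by positivity, fun p v hv => ?_⟩
  set ω := ε / (2 * H * G + 1) with hω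
  have hω0 : 0 ≤ ω := by positivity
  have hωC : ω * (2 * H * G + 1) = ε := div_mul_cancel₀ _ hC.ne'
  set q := ∑ k, (v k - rx N k p) • g k with hq
  have hqn : ‖q‖ ≤ ω * G := by
    rw [hq, Finset.mul_sum]
    refine (norm_sum_le _ _).trans (Finset.sum_le_sum fun k _ => ?_)
    rw [norm_smul]
    exact mul_le_mul_of_nonneg_right (hv k) (norm_nonneg _)
  have hrx : ∀ k, rx N k (p + q) = v k := fun k => by
    have h1 : rx N k q = v k - rx N k p := by
      have : ∀ j, inner ℂ (N.h k) (g j) = if k = j then (1 : ℂ) else 0 := hg k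
      rw [hq, rx, inner_sum]
      simp [inner_smul_right, this]
    rw [rx, inner_add_right]
    change rx N k p + rx N k q = v k
    rw [h1]
    ring
  obtain ⟨r, hr, h1, h2⟩ := exists_shrink p q
  refine ⟨(r : ℂ) • (p + q), r, hr, h1, fun k => ?_, fun k => ?_⟩
  · rw [← hrx k, rx, inner_smul_right]
    rfl
  · have h3 : rx N k ((r : ℂ) • (p + q)) - rx N k p = rx N k ((r : ℂ) • (p + q) - p) := by
      simp only [rx, inner_sub_right]
    have h4 : ‖N.h k‖ ≤ H :=
      Finset.single_le_sum (f := fun k => ‖N.h k‖) (fun i _ => norm_nonneg _) (Finset.mem_univ k)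
    rw [h3]
    calc _ ≤ ‖N.h k‖ * ‖(r : ℂ) • (p + q) - p‖ := norm_rx_le N k _
      _ ≤ H * (2 * (ω * G)) := mul_le_mul h4 (h2.trans (by linarith)) (norm_nonneg _) hH
      _ = ω * (2 * H * G + 1) - ω := by ring
      _ ≤ ε := by rw [hωC]; linarith

lemma norm_exp_sub_exp_le (α φ : ℝ) :
    ‖Complex.exp (α * Complex.I) - Complex.exp (φ * Complex.I)‖ ≤ |α - φ| := by
  have h : Complex.exp (α * Complex.I) - Complex.exp (φ * Complex.I) =
      Complex.exp (φ * Complex.I) * (Complex.exp (Complex.I * ((α - φ : ℝ) : ℂ)) - 1) := by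
    rw [mul_sub, ← Complex.exp_add, mul_one]
    congr 2
    push_cast
    ring
  rw [h, norm_mul, Complex.norm_exp_ofReal_mul_I, one_mul]
  exact Real.norm_exp_I_mul_ofReal_sub_one_le

/-- By subadditivity of the square root, raising the level by `ω` costs at most `√ω √B ≤ a`. -/
lemma sqrt_mul_sqrt_le {γ l J ω B a : ℝ} (hl : 0 ≤ l) (hω : 0 ≤ ω) (ha : 0 ≤ a) (hγ : γ ≤ l + ω)
    (hJ : J ≤ B) (hB : ω * B ≤ a ^ 2) : √γ * √J ≤ √l * √J + a := by
  have h1 : √γ ≤ √l + √ω := by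
    refine (Real.sqrt_le_sqrt hγ).trans ?_
    rw [Real.sqrt_le_left (by positivity), add_sq, Real.sq_sqrt hl, Real.sq_sqrt hω]
    have : 0 ≤ 2 * √l * √ω := by positivity
    linarith
  have h2 : √ω * √J ≤ a := by
    rw [← Real.sqrt_mul hω, Real.sqrt_le_left ha]
    exact (mul_le_mul_of_nonneg_left hJ hω).trans hB
  calc √γ * √J ≤ (√l + √ω) * √J := by gcongr
    _ = √l * √J + √ω * √J := by ring
    _ ≤ _ := by linarith

variable [NeZero K]

/-- For small boxes, the common beamformer can be adapted to the angles of the dual feasible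
point. -/
lemma exists_adapted_beam (rule : AngleRule)
    (hrule : rule = AngleRule.endpoint → LinearIndependent ℂ N.h) {ε : ℝ} (hε : 0 < ε) :
    ∃ ω > 0, ∀ (l r α : Others K → ℝ) (p : EuclideanSpace ℂ (Fin M)), (∀ k, r k - l k ≤ ω) →
      ‖p‖ ^ 2 ≤ N.P → 0 ≤ (rx N 0 p).re ∧ (rx N 0 p).im = 0 →
      (∀ k : Others K, ∃ φ ∈ Set.Icc (l k) (r k), IsAngle (rx N k p) φ) →
      (∀ k : Others K, rule.Picks (l k) (r k) (rx N k p) (α k)) →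
      ∃ p' : EuclideanSpace ℂ (Fin M), ‖p'‖ ≤ ‖p‖ ∧
        (0 ≤ (rx N 0 p').re ∧ (rx N 0 p').im = 0) ∧
        (∀ k : Others K, IsAngle (rx N k p') (α k)) ∧ ∀ k, ‖rx N k p' - rx N k p‖ ≤ ε := by
  cases rule with
  | argument =>
    refine ⟨1, one_pos, fun l r α p _ _ h0 _ hα => ⟨p, le_rfl, h0, fun k => (hα k).2, fun k => ?_⟩⟩
    simpa using hε.le
  | endpoint =>
    obtain ⟨ω, hω, hpert⟩ := exists_perturbation N (hrule rfl) hε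
    have hG := gainBound_nonneg N
    refine ⟨ω / (gainBound N + 1), by positivity, fun l r α p hlr hp h0 hφ hα => ?_⟩
    -- The target gains keep all moduli and the gain of the first user, and turn the others to `α`.
    -- The common factor `ρ ≥ 0` of the perturbation preserves these angles.
    let v : Fin K → ℂ := fun k => if hk : k = 0 then rx N 0 p
      else (‖rx N k p‖ : ℂ) * Complex.exp (α ⟨k, hk⟩ * Complex.I)
    have hv0 : v 0 = rx N 0 p := by simp [v]
    have hvk : ∀ k : Others K, v k = (‖rx N k p‖ : ℂ) * Complex.exp (α k * Complex.I) := by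
      rintro ⟨k, hk⟩
      simp [v, hk]
    have hv : ∀ k, ‖v k - rx N k p‖ ≤ ω := fun k => by
      by_cases hk : k = 0
      · subst hk
        rw [hv0, sub_self, norm_zero]
        exact hω.le
      · obtain ⟨φ, ⟨h1, h2⟩, h3⟩ := hφ ⟨k, hk⟩
        obtain ⟨θ, -, -, h4, -⟩ := hα ⟨k, hk⟩
        -- An end point and the argument `φ` lie in the same interval, so they differ by at most its
        -- width.
        have h5 : |α ⟨k, hk⟩ - φ| ≤ ω / (gainBound N + 1) := by
          refine le_trans ?_ (hlr ⟨k, hk⟩)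
          rw [abs_le]
          rcases h4 with h | h <;> rw [h] <;> constructor <;> linarith
        have h6 : v k - rx N k p = (‖rx N k p‖ : ℂ) *
            (Complex.exp (α ⟨k, hk⟩ * Complex.I) - Complex.exp (φ * Complex.I)) := by
          rw [mul_sub, hvk ⟨k, hk⟩]
          exact congrArg _ h3
        rw [h6, norm_mul, Complex.norm_real, norm_norm]
        calc _ ≤ gainBound N * (ω / (gainBound N + 1)) :=
              mul_le_mul (norm_rx_le_gainBound N k p hp) ((norm_exp_sub_exp_le _ _).trans h5)
                (norm_nonneg _) hG
          _ = gainBound N / (gainBound N + 1) * ω := by ring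
          _ ≤ 1 * ω := by
              gcongr
              exact (div_le_one (by positivity)).2 (by linarith)
          _ = ω := one_mul _
    obtain ⟨p', ρ, hρ, h1, h2, h3⟩ := hpert p v hv
    refine ⟨p', h1, ?_, fun k => ?_, h3⟩
    · rw [h2, hv0, Complex.re_ofReal_mul, Complex.im_ofReal_mul, h0.2, mul_zero]
      exact ⟨mul_nonneg hρ h0.1, rfl⟩
    · rw [h2, hvk, ← mul_assoc, ← Complex.ofReal_mul]
      exact isAngle_mul_exp (by positivity) _

/-- Sufficiently small boxes that are not pruned have a candidate. -/
lemma exists_small_box_size (rule : AngleRule)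
    (hrule : rule = AngleRule.endpoint → LinearIndependent ℂ N.h) {ε : ℝ} (hε : 0 < ε) :
    ∃ ω > 0, ∀ (δ : ℝ) (b : Box K), 0 ≤ δ → (∀ i, 0 ≤ b.lo i) → AngleOK b →
      (∀ i, b.hi i - b.lo i < ω) → bound N δ b ≤ ((-ε : ℝ) : EReal) →
      ∀ o, FeasPoint N rule δ b o → o ≠ none := by
  obtain ⟨ω₁, hω₁, hadapt⟩ := exists_adapted_beam N rule hrule (ε := ε / 4) (by positivity)
  have hG := gainBound_nonneg N
  have hB := noiseBound_pos N
  set G := gainBound N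
  set B := noiseBound N
  -- The four terms serve the change of angles, the estimate `w ^ 2 ≤ w` together with an active
  -- cut, the rise of the SINR levels, and the gap between chord and circle.
  refine ⟨min (min ω₁ 1) (min ((ε / 4) ^ 2 / B) (ε / 4 / (G + 1))), by positivity, ?_⟩
  set ω := min (min ω₁ 1) (min ((ε / 4) ^ 2 / B) (ε / 4 / (G + 1)))
  have hω : 0 < ω := by positivity
  have hωω₁ : ω ≤ ω₁ := (min_le_left _ _).trans (min_le_left _ _)
  have hω1 : ω ≤ 1 := (min_le_left _ _).trans (min_le_right _ _)
  have hωB : ω * B ≤ (ε / 4) ^ 2 :=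
    (le_div_iff₀ hB).1 ((min_le_right _ _).trans (min_le_left _ _))
  have hωG : ω * (G + 1) ≤ ε / 4 :=
    (le_div_iff₀ (by positivity)).1 ((min_le_right _ _).trans (min_le_right _ _))
  intro δ b hδ hlo hb hsmall hbound o ho hnone
  have hneg : bound N δ b < 0 := hbound.trans_lt (by exact_mod_cast neg_lt_zero.2 hε)
  rcases ho with ⟨h, -⟩ | ⟨-, x, t, hx, ht, α, hα, z, τ, hz, hmin, hcase⟩
  · exact lt_asymm h hneg
  have hτ : 0 < τ := by
    rcases hcase with h | ⟨-, _, -, h⟩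
    · exact h.1
    · exact absurd (h.symm.trans hnone) (Option.some_ne_none _)
  have ht' : t ≤ -ε := by
    rw [← ht] at hbound
    exact_mod_cast hbound
  have hang := hx.exists_isAngle hb
  obtain ⟨hγ, hs⟩ := hx.rpow_mem hlo
  have hx' := hx
  obtain ⟨-, h2, h3, h4, -, -, -, -, ⟨h9, h10, h11⟩, h12⟩ := hx'
  have hpc : ‖x.beam.pc‖ ^ 2 ≤ N.P := (norm_pc_sq_le_power _).trans h4
  obtain ⟨p, hp, hp0, hpα, hpd⟩ := hadapt (fun k => b.lo (cα k)) (fun k => b.hi (cα k)) α x.beam.pc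
    (fun k => (hsmall _).le.trans hωω₁) hpc h2.2
    (fun k => by rw [← (h3 k).2]; exact hang k) (fun k => by rw [← (h3 k).2]; exact hα k)
  have hgap : ∀ i (v : ℝ), v ∈ Set.Icc (b.lo i) (b.hi i) → v ≤ b.lo i + ω := fun i v hv => by
    linarith [hsmall i, hv.2]
  have hsC : ∀ k, √((2 : ℝ) ^ x.s - 1) * √(noiseC N x.beam k) ≤
      √(b.lo cs) * √(noiseC N x.beam k) + ε / 4 := fun k =>
    sqrt_mul_sqrt_le (hlo _) hω.le (by positivity) (hgap cs _ hs) (noiseC_le N x.beam h4 k) hωB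
  -- A test point with `t = 0` contradicts the positive minimum `τ`.
  suffices hsoc : SocOK N ⟨p, x.beam.pp⟩ (fun k => ‖rx N k p‖) (fun k => (2 : ℝ) ^ x.γ k - 1)
      ((2 : ℝ) ^ x.s - 1) 0 by
    obtain ⟨z', hz'⟩ := hx.testFeasible hδ hp hp0 hpα (fun k => norm_nonneg _)
      (fun k => by rw [sub_zero]) hsoc
    exact absurd hτ (hmin z' 0 hz').not_gt
  refine ⟨fun k => ?_, ?_, fun k => ?_⟩
  · have h1 := sqrt_mul_sqrt_le (hlo _) hω.le (a := ε / 4) (by positivity) (hgap (cγ k) _ (hγ k))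
      ((noiseP_le_noiseC N x.beam k).trans (noiseC_le N x.beam h4 k)) hωB
    change √((2 : ℝ) ^ x.γ k - 1) * √(noiseP N x.beam k) ≤ 0 + (rx N k (x.beam.pp k)).re
    linarith [h9 k]
  · have h1 := hsC 0
    have h5 := (Complex.abs_re_le_norm _).trans (hpd 0)
    rw [Complex.sub_re, abs_le] at h5
    change √((2 : ℝ) ^ x.s - 1) * √(noiseC N x.beam 0) ≤ 0 + (rx N 0 p).re
    linarith
  · have h1 := hsC k
    have h5 := norm_sub_norm_le (rx N k x.beam.pc) (rx N k p)
    rw [norm_sub_rev] at h5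
    have h6 := hpd k
    have h7 := h11 k
    have hw := hsmall (cα k)
    have hw0 := (hb k).1
    have hcut := h12 k (by linarith [Real.pi_gt_three])
    have hcos := Real.one_sub_sq_div_two_le_cos (x := (b.hi (cα k) - b.lo (cα k)) / 2)
    set w := (b.hi (cα k) - b.lo (cα k)) / 2 with hwdef
    have hw1 : w ^ 2 ≤ w := by nlinarith
    have hwω : w ≤ ω := by linarith
    have hcut' := hcut.mul_cos_le (by rw [← hwdef]; linarith)
    rw [← hwdef, (h3 k).2] at hcut'
    have he : ‖rx N k x.beam.pc‖ ≤ G := norm_rx_le_gainBound N k _ hpc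
    have hdt : 0 ≤ x.d k - t := by linarith [(h3 k).1]
    have h8 : (x.d k - t) * (1 - w ^ 2 / 2) ≤ ‖rx N k x.beam.pc‖ :=
      (mul_le_mul_of_nonneg_left hcos hdt).trans hcut'
    -- Here `w ^ 2 ≤ 1`, so the factor `1 - w ^ 2 / 2` is at least one half.
    have h13 : x.d k - t ≤ 2 * G := by nlinarith
    have h14 : (x.d k - t) * (w ^ 2 / 2) ≤ 2 * G * (ω / 2) := by
      gcongr
      exact hw1.trans hwω
    change √((2 : ℝ) ^ x.s - 1) * √(noiseC N x.beam k) ≤ 0 + ‖rx N k p‖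
    -- The left side is at most `t + d_k + ε / 4 = 2 t + (d_k - t) + ε / 4`, and `d_k - t` exceeds
    -- the new gain by at most `ε / 4` for the cut plus `ε / 4` for the angles; `t ≤ -ε` absorbs all
    -- three.
    nlinarith

end SmallBoxes

/-! ### The invariant of a run, correctness and termination. -/

section Run

variable {M K : ℕ} [NeZero K] {N : Network M K}

/-- Invariant of the boxes produced by the reduction. -/
structure Box.Valid (b : Box K) : Prop where
  lo_nonneg : ∀ i, 0 ≤ b.lo i
  angle : AngleOK b

lemma redHi_le (δ : ℝ) (b : Box K) (i : Coord K) : redHi N δ b i ≤ b.hi i := by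
  unfold redHi
  split_ifs with h
  · exact le_rfl
  · rcases i with k | _ | k
    · exact min_le_left _ _
    · exact min_le_left _ _
    · exact le_rfl

lemma le_redLo (δ : ℝ) (b : Box K) (i : Coord K) : b.lo i ≤ redLo N δ b i := by
  rcases i with k | _ | k
  · exact le_max_left _ _
  · exact le_max_left _ _
  · exact le_rfl

lemma reduce_edge_le (δ : ℝ) (b : Box K) (i : Coord K) :
    (reduce N δ b).hi i - (reduce N δ b).lo i ≤ b.hi i - b.lo i :=
  sub_le_sub (redHi_le δ b i) (le_redLo δ b i)

lemma Box.Valid.reduce {b : Box K} (hb : b.Valid) (δ : ℝ) : (reduce N δ b).Valid where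
  lo_nonneg i := (hb.lo_nonneg i).trans (le_redLo δ b i)
  angle k := by
    have h : redHi N δ b (cα k) = b.hi (cα k) := by
      unfold redHi
      split_ifs <;> rfl
    change b.lo (cα k) < redHi N δ b (cα k) ∧ (redHi N δ b (cα k) - b.lo (cα k) ≤ _ ∨
      (b.lo (cα k) = 0 ∧ redHi N δ b (cα k) = _))
    rw [h]
    exact hb.angle k

lemma half_edge_self (b : Box K) (j : Coord K) (i : Bool) :
    (half b j i).hi j - (half b j i).lo j = (b.hi j - b.lo j) / 2 := by
  cases i <;> simp [half] <;> ring

lemma half_edge_of_ne (b : Box K) {j i' : Coord K} (h : i' ≠ j) (i : Bool) :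
    (half b j i).hi i' = b.hi i' ∧ (half b j i).lo i' = b.lo i' := by
  cases i <;> simp [half, h]

lemma half_edge_le {b : Box K} (hb : ∀ i, b.lo i ≤ b.hi i) (j : Coord K) (i : Bool)
    (i' : Coord K) : (half b j i).hi i' - (half b j i).lo i' ≤ b.hi i' - b.lo i' := by
  by_cases h : i' = j
  · subst h
    rw [half_edge_self]
    linarith [hb i']
  · rw [(half_edge_of_ne b h i).1, (half_edge_of_ne b h i).2]

lemma le_half_lo {b : Box K} (hb : ∀ i, b.lo i ≤ b.hi i) (j : Coord K) (i : Bool) (i' : Coord K) :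
    b.lo i' ≤ (half b j i).lo i' := by
  by_cases h : i' = j
  · subst h
    cases i
    · exact le_rfl
    · simp only [half, Function.update_self]
      linarith [hb i']
  · exact (half_edge_of_ne b h i).2.ge

lemma Box.Valid.half {b : Box K} (hb : b.Valid) (hne : ∀ i, b.lo i ≤ b.hi i) (j : Coord K)
    (i : Bool) : (half b j i).Valid where
  lo_nonneg i' := (hb.lo_nonneg i').trans (le_half_lo hne j i i')
  angle k := by
    by_cases h : cα k = j
    · subst h
      have h1 := half_edge_self b (cα k) i
      have h2 := hb.angle k
      -- One bisection of the full circle already gives length `π`, from where on the cut is active.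
      have h3 : b.hi (cα k) - b.lo (cα k) ≤ 2 * Real.pi := by
        rcases h2.2 with h | ⟨h, h'⟩ <;> linarith [Real.pi_pos]
      exact ⟨by linarith [h2.1], .inl (by linarith)⟩
    · rw [(half_edge_of_ne b h i).1, (half_edge_of_ne b h i).2]
      exact hb.angle k

/-- Number of bisections after which an edge of length `l` is shorter than `ω`. -/
noncomputable def edgeSize (ω l : ℝ) : ℕ := Nat.size ⌊l / ω⌋₊

/-- Number of bisections after which all edges are shorter than `ω`. -/
noncomputable def boxSize (ω : ℝ) (b : Box K) : ℕ := ∑ i, edgeSize ω (b.hi i - b.lo i)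

lemma edgeSize_mono {ω l l' : ℝ} (hω : 0 < ω) (h : l ≤ l') : edgeSize ω l ≤ edgeSize ω l' :=
  Nat.size_le_size (Nat.floor_mono (by gcongr))

lemma edgeSize_eq_zero {ω l : ℝ} (hω : 0 < ω) : edgeSize ω l = 0 ↔ l < ω := by
  rw [edgeSize, Nat.size_eq_zero, Nat.floor_eq_zero, div_lt_one hω]

lemma size_half_lt {n : ℕ} (hn : n ≠ 0) : Nat.size (n / 2) < Nat.size n := by
  by_contra! h
  rcases Nat.eq_zero_or_pos (Nat.size n) with h0 | h0
  · exact hn (Nat.size_eq_zero.1 h0)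
  · obtain ⟨m, hm⟩ := Nat.exists_eq_add_of_lt h0
    have h1 : 2 ^ m ≤ n / 2 := Nat.lt_size.1 (by omega)
    have h2 : 2 ^ (m + 1) ≤ n := by rw [pow_succ]; omega
    have := Nat.lt_size.2 h2
    omega

/-- Halving the edge deletes the last binary digit of `⌊l / ω⌋₊`. -/
lemma edgeSize_half_lt {ω l : ℝ} (hω : 0 < ω) (hl : ω ≤ l) :
    edgeSize ω (l / 2) < edgeSize ω l := by
  have h : ⌊l / 2 / ω⌋₊ = ⌊l / ω⌋₊ / 2 := by
    rw [div_right_comm, Nat.floor_div_ofNat]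
  rw [edgeSize, h]
  refine size_half_lt fun h0 => ?_
  rw [Nat.floor_eq_zero, div_lt_one hω] at h0
  linarith

lemma boxSize_eq_zero {ω : ℝ} (hω : 0 < ω) {b : Box K} :
    boxSize ω b = 0 ↔ ∀ i, b.hi i - b.lo i < ω := by
  simp only [boxSize, Finset.sum_eq_zero_iff, edgeSize_eq_zero hω, Finset.mem_univ, true_imp_iff]

/-- If some edge is at least `ω` long, then so is the longest one, which is the one bisected; no
other edge grows. -/
lemma boxSize_child_lt {ω δ : ℝ} (hω : 0 < ω) {b : Box K} (hne : ∀ i, b.lo i ≤ b.hi i)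
    {j : Coord K} (hj : ∀ i, b.hi i - b.lo i ≤ b.hi j - b.lo j) (h0 : boxSize ω b ≠ 0) (i : Bool) :
    boxSize ω (reduce N δ (half b j i)) < boxSize ω b := by
  have hj' : ω ≤ b.hi j - b.lo j := by
    by_contra! h
    exact h0 ((boxSize_eq_zero hω).2 fun i => (hj i).trans_lt h)
  refine Finset.sum_lt_sum (fun i' _ => edgeSize_mono hω ((reduce_edge_le δ _ i').trans
    (half_edge_le hne j i i'))) ⟨j, Finset.mem_univ j, ?_⟩
  refine (edgeSize_mono hω (reduce_edge_le δ _ j)).trans_lt ?_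
  rw [half_edge_self]
  exact edgeSize_half_lt hω hj'

/-- Invariant of the states of a run. -/
structure State.Valid (N : Network M K) (ε η : ℝ) (S : State M K) : Prop where
  δ_nonneg : 0 ≤ S.δ
  nodes : ∀ n ∈ S.nodes, n.box.Valid ∧ ∀ i, n.box.lo i ≤ n.box.hi i
  best : (S.best = none ∧ S.δ = 0) ∨
    ∃ x, S.best = some x ∧ Feasible N x ∧ S.δ = objective N x + η
  cover : ∀ z, EssentialFeasible N ε z → S.δ ≤ objective N z → ∀ α : Others K → ℝ,
    (∀ k, α k ∈ Set.Icc 0 (2 * Real.pi) ∧ IsAngle (z.e k) (α k)) →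
    ∃ n ∈ S.nodes, n.box.Mem (coords z.γ z.s α)

lemma Feasible.objective_nonneg {x : Point M K} (hx : Feasible N x) : 0 ≤ objective N x :=
  RSMA.objective_nonneg N (hx.2.2.2.2.2.1.nonneg N) hx.2.2.2.1

lemma Feasible.coord_le {x : Point M K} (hx : Feasible N x) :
    (∀ k, x.γ k ≤ N.P * ‖N.h k‖ ^ 2) ∧ ∀ k, x.s ≤ N.P * ‖N.h k‖ ^ 2 := by
  have hP := hx.2.2.1
  refine ⟨fun k => (hx.γ_le k).trans ?_, fun k => (hx.s_le k).trans ?_⟩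
  · rw [mul_comm]
    exact mul_le_mul_of_nonneg_right ((norm_pp_sq_le_power _ k).trans hP) (by positivity)
  · rw [mul_comm]
    exact mul_le_mul_of_nonneg_right ((norm_pc_sq_le_power _).trans hP) (by positivity)

lemma exists_objective_le (N : Network M K) : ∃ D, ∀ x, Feasible N x → objective N x ≤ D := by
  refine ⟨(∑ k, N.u k * (lg (1 + N.P * ‖N.h 0‖ ^ 2) + lg (1 + N.P * ‖N.h k‖ ^ 2))) / N.Pc,
    fun x hx => ?_⟩
  have hP := N.P_nonneg
  have hγ0 := hx.2.2.2.1
  have hs0 := hx.2.2.2.2.1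
  have hr := hx.2.2.2.2.2.1
  obtain ⟨hγ, hs⟩ := hx.coord_le
  have h1 : 0 ≤ N.μ * power x.beam := mul_nonneg N.μ_nonneg (power_nonneg _)
  refine div_le_div₀ (Finset.sum_nonneg fun k _ => mul_nonneg (N.u_nonneg k) (add_nonneg
    (lg_one_add_nonneg (by positivity)) (lg_one_add_nonneg (by positivity))))
    (Finset.sum_le_sum fun k _ => mul_le_mul_of_nonneg_left (add_le_add ?_ ?_) (N.u_nonneg k))
    N.Pc_pos (by linarith)
  · exact (hr.le N k).trans (lg_mono (by linarith) (by linarith [hs 0]))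
  · exact lg_mono (by linarith [hγ0 k]) (by linarith [hγ k])

lemma box0_valid (N : Network M K) : (box0 N).Valid ∧ ∀ i, (box0 N).lo i ≤ (box0 N).hi i := by
  have hP := N.P_nonneg
  have hpi := Real.pi_pos
  refine ⟨⟨fun i => le_rfl, fun k => ?_⟩, fun i => ?_⟩
  · change 0 < 2 * Real.pi ∧ (_ ∨ ((0 : ℝ) = 0 ∧ 2 * Real.pi = 2 * Real.pi))
    exact ⟨by positivity, .inr ⟨rfl, rfl⟩⟩
  · rcases i with k | _ | k
    · change 0 ≤ N.P * ‖N.h k‖ ^ 2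
      positivity
    · exact Real.iInf_nonneg fun k => by positivity
    · change 0 ≤ 2 * Real.pi
      positivity

lemma IsInit.valid {ε η : ℝ} (hε : 0 < ε) (hη : 0 < η) {S : State M K} (h : IsInit N η S) :
    S.Valid N ε η := by
  obtain ⟨hnodes, hbest⟩ := h
  have hb : (S.best = none ∧ S.δ = 0) ∨
      ∃ x, S.best = some x ∧ Feasible N x ∧ S.δ = objective N x + η := by
    rcases hbest with ⟨h1, h2⟩ | ⟨y, c, h1, h2, h3, -, h4, h5⟩
    · exact .inl ⟨h2, h1⟩
    · exact .inr ⟨_, h5, recover_feasible N h1 h2 h3, h4.trans (add_comm _ _)⟩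
  refine ⟨?_, fun n hn => ?_, hb, fun z hz _ α hα => ?_⟩
  · rcases hb with ⟨-, h⟩ | ⟨x, -, hx, h⟩
    · exact h.ge
    · rw [h]
      exact add_nonneg hx.objective_nonneg hη.le
  · rw [hnodes, Finset.mem_singleton] at hn
    rw [hn]
    exact box0_valid N
  · refine ⟨_, by rw [hnodes]; exact Finset.mem_singleton_self _, fun i => ?_⟩
    have hf := hz.feasible hε.le
    obtain ⟨hγ, hs⟩ := hf.coord_le
    rcases i with k | _ | k
    · exact ⟨hf.2.2.2.1 k, hγ k⟩
    · exact ⟨hf.2.2.2.2.1, le_ciInf hs⟩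
    · exact (hα k).1

/-- Either nothing changes, because there is no candidate, or a candidate becomes the incumbent. -/
lemma incumbent_cases {rule : AngleRule} {η : ℝ} (hη : 0 < η) {S S' : State M K}
    {kid : Bool → Box K} {o : Bool → Option (Point M K)}
    (ho : ∀ i, FeasPoint N rule S.δ (kid i) (o i))
    (h : ∃ i, (∀ i', value N (o i') ≤ value N (o i)) ∧
      ((((S.δ - η : ℝ) : EReal) < value N (o i) ∧
          ∃ x, o i = some x ∧ S'.best = some x ∧ S'.δ = objective N x + η) ∨
        (value N (o i) ≤ ((S.δ - η : ℝ) : EReal) ∧ S'.best = S.best ∧ S'.δ = S.δ))) :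
    (S'.best = S.best ∧ S'.δ = S.δ ∧ ∀ i, o i = none) ∨
      ∃ x, Feasible N x ∧ S'.best = some x ∧ S'.δ = objective N x + η ∧ S.δ ≤ objective N x := by
  obtain ⟨i, hmax, ⟨-, x, h1, h2, h3⟩ | ⟨h1, h2, h3⟩⟩ := h
  · obtain ⟨h4, h5⟩ := (ho i).feasible h1
    exact .inr ⟨x, h4, h2, h3, h5⟩
  · refine .inl ⟨h2, h3, fun i' => ?_⟩
    by_contra hne
    obtain ⟨x, hx⟩ := Option.ne_none_iff_exists'.1 hne
    have h4 := ((ho i').feasible hx).2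
    have h5 := (hmax i').trans h1
    rw [hx] at h5
    have h6 : objective N x ≤ S.δ - η := EReal.coe_le_coe_iff.1 h5
    linarith

lemma Step.δ_le {rule : AngleRule} {ε η : ℝ} (hη : 0 < η) {S S' : State M K}
    (h : Step N rule ε η S S') : S.δ ≤ S'.δ := by
  obtain ⟨n, -, -, j, -, kid, -, o, ho, hinc, -⟩ := h
  rcases incumbent_cases hη ho hinc with ⟨-, h, -⟩ | ⟨x, -, -, h, h'⟩ <;> linarith

/-- For the covering property, a point of the bisected box lies in one half, survives its reduction,
and forces its bound to be at most `-ε`. A larger `δ` only weakens the claim. -/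
lemma Step.valid {rule : AngleRule} {ε η : ℝ} (hε : 0 < ε) (hη : 0 < η) {S S' : State M K}
    (hS : S.Valid N ε η) (h : Step N rule ε η S S') : S'.Valid N ε η := by
  classical
  have hδ := h.δ_le hη
  obtain ⟨n, hn, -, j, -, kid, hkid, o, ho, hinc, hnodes⟩ := h
  have hcases := incumbent_cases hη ho hinc
  have hkv : ∀ i, (kid i).Valid := fun i => by
    rw [hkid]
    exact ((hS.nodes n hn).1.half (hS.nodes n hn).2 j i).reduce _
  refine ⟨hS.δ_nonneg.trans hδ, fun m hm => ?_, ?_, fun z hz hobj α hα => ?_⟩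
  · rw [hnodes, Finset.mem_union, Finset.mem_filter, Finset.mem_image] at hm
    rcases hm with ⟨⟨i, -, rfl⟩, hβ⟩ | hm
    · refine ⟨hkv i, ?_⟩
      -- An empty box has bound `∞`, so a box that is kept is nonempty.
      obtain ⟨x, t, hx, -⟩ := exists_eq_bound (hβ.trans_lt (EReal.coe_lt_top _))
      exact hx.1
    · exact hS.nodes m (Finset.mem_of_mem_erase hm)
  · rcases hcases with ⟨h1, h2, -⟩ | ⟨x, h1, h2, h3, -⟩
    · rw [h1, h2]
      exact hS.best
    · exact .inr ⟨x, h2, h1, h3⟩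
  · obtain ⟨m, hm, hmem⟩ := hS.cover z hz (hδ.trans hobj) α hα
    rw [hnodes]
    by_cases hmn : m = n
    · subst hmn
      obtain ⟨i, hi⟩ := exists_mem_half hmem j
      have hi' := mem_reduce (hz.feasible hε.le) hi hS.δ_nonneg (hδ.trans hobj)
      rw [← hkid] at hi'
      refine ⟨⟨kid i, bound N S.δ (kid i)⟩, Finset.mem_union_left _ (Finset.mem_filter.2
        ⟨Finset.mem_image_of_mem _ (Finset.mem_univ i), ?_⟩), hi'⟩
      exact bound_le_of_mem hε.le hz (fun k => (hα k).2) (hkv i).lo_nonneg hi' (hδ.trans hobj)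
    · exact ⟨m, Finset.mem_union_right _ (Finset.mem_erase.2 ⟨hmn, hm⟩), hmem⟩

lemma Reachable.valid {rule : AngleRule} {ε η : ℝ} (hε : 0 < ε) (hη : 0 < η) {S : State M K}
    (h : Reachable N rule ε η S) : S.Valid N ε η := by
  obtain ⟨S₀, h0, hrun⟩ := h
  induction hrun with
  | refl => exact h0.valid hε hη
  | tail _ hstep ih => exact hstep.valid hε hη ih

lemma State.Valid.correct {ε η : ℝ} {S : State M K} (hS : S.Valid N ε η)
    (hempty : S.nodes = ∅) (hε : 0 < ε) : Correct N ε η S := by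
  have key : ∀ z, EssentialFeasible N ε z → objective N z < S.δ := fun z hz => by
    by_contra! h
    choose α hα using fun k => exists_isAngle (z.e k)
    obtain ⟨n, hn, -⟩ := hS.cover z hz h α hα
    simp [hempty] at hn
  unfold Correct
  rcases hS.best with ⟨h1, h2⟩ | ⟨x, h1, h2, h3⟩ <;> rw [h1]
  · intro z hz
    have := key z hz
    rw [h2] at this
    exact this.not_ge (hz.feasible hε.le).objective_nonneg
  · exact ⟨h2, fun z hz => h3 ▸ (key z hz).le⟩

/-- The algorithm can proceed while boxes remain. -/
lemma State.Valid.exists_step {ε η : ℝ} {S : State M K} (hS : S.Valid N ε η) (rule : AngleRule)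
    (hne : S.nodes.Nonempty) : ∃ S', Step N rule ε η S S' := by
  classical
  obtain ⟨n, hn, hmin⟩ := Finset.exists_min_image S.nodes Node.β hne
  have : Nonempty (Coord K) := ⟨cs⟩
  obtain ⟨j, hj⟩ := Finite.exists_max fun i => n.box.hi i - n.box.lo i
  let kid : Bool → Box K := fun i => reduce N S.δ (half n.box j i)
  have hkv : ∀ i, (kid i).Valid := fun i =>
    ((hS.nodes n hn).1.half (hS.nodes n hn).2 j i).reduce _
  choose o ho using fun i => exists_feasPoint (N := N) rule hS.δ_nonneg (hkv i).lo_nonneg (hkv i).angle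
  obtain ⟨i, hi⟩ := Finite.exists_max fun i => value N (o i)
  have hinc : ∃ (δ' : ℝ) (best' : Option (Point M K)),
      (((S.δ - η : ℝ) : EReal) < value N (o i) ∧
        ∃ x, o i = some x ∧ best' = some x ∧ δ' = objective N x + η) ∨
      (value N (o i) ≤ ((S.δ - η : ℝ) : EReal) ∧ best' = S.best ∧ δ' = S.δ) := by
    rcases lt_or_ge ((S.δ - η : ℝ) : EReal) (value N (o i)) with h | h
    · have hsome : o i ≠ none := fun h0 => by
        rw [h0] at h
        exact not_lt_bot h
      obtain ⟨x, hx⟩ := Option.ne_none_iff_exists'.1 hsome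
      exact ⟨_, _, .inl ⟨h, x, hx, rfl, rfl⟩⟩
    · exact ⟨_, _, .inr ⟨h, rfl, rfl⟩⟩
  obtain ⟨δ', best', hinc⟩ := hinc
  exact ⟨⟨_, δ', best'⟩, n, hn, hmin, j, hj, kid, fun _ => rfl, o, ho, ⟨i, hi, hinc⟩, rfl⟩

/-- Potential of the current partition. -/
noncomputable def potential (ω : ℝ) (S : State M K) : ℕ := ∑ n ∈ S.nodes, 3 ^ boxSize ω n.box

/-- Steps that do not change the incumbent decrease the potential. -/
lemma Step.potential_lt {rule : AngleRule} {ε η ω : ℝ} (hω : 0 < ω) (hη : 0 < η)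
    (hsmall : ∀ (δ : ℝ) (b : Box K), 0 ≤ δ → (∀ i, 0 ≤ b.lo i) → AngleOK b →
      (∀ i, b.hi i - b.lo i < ω) → bound N δ b ≤ ((-ε : ℝ) : EReal) →
      ∀ o, FeasPoint N rule δ b o → o ≠ none)
    {S S' : State M K} (hS : S.Valid N ε η) (h : Step N rule ε η S S') :
    potential ω S' < potential ω S ∨ (S.δ + η ≤ S'.δ ∧ ∃ x, Feasible N x ∧
      S'.δ = objective N x + η) := by
  classical
  obtain ⟨n, hn, -, j, hj, kid, hkid, o, ho, hinc, hnodes⟩ := h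
  rcases incumbent_cases hη ho hinc with ⟨-, -, hnone⟩ | ⟨x, hx, -, h1, h2⟩
  swap
  · exact .inr ⟨by linarith, x, hx, h1⟩
  left
  obtain ⟨hv, hne⟩ := hS.nodes n hn
  have hkv : ∀ i, (kid i).Valid := fun i => by
    rw [hkid]
    exact (hv.half hne j i).reduce _
  set A := (Finset.univ.image fun i => (⟨kid i, bound N S.δ (kid i)⟩ : Node K)).filter
    (fun m => m.β ≤ ((-ε : ℝ) : EReal)) with hA
  have hkids : ∑ m ∈ A, 3 ^ boxSize ω m.box < 3 ^ boxSize ω n.box := by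
    by_cases h0 : boxSize ω n.box = 0
    · have hempty : A = ∅ := by
        rw [Finset.eq_empty_iff_forall_notMem]
        intro m hm
        rw [hA, Finset.mem_filter, Finset.mem_image] at hm
        obtain ⟨⟨i, -, rfl⟩, hβ⟩ := hm
        refine hsmall S.δ (kid i) hS.δ_nonneg (hkv i).lo_nonneg (hkv i).angle (fun i' => ?_) hβ
          (o i) (ho i) (hnone i)
        rw [hkid]
        exact ((reduce_edge_le _ _ i').trans (half_edge_le hne j i i')).trans_lt
          ((boxSize_eq_zero hω).1 h0 i')
      rw [hempty, Finset.sum_empty]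
      positivity
    -- At most two children remain, each of smaller size, so base `3` makes their sum strictly
    -- smaller than the term of the parent.
    · have hle : ∀ m ∈ A, 3 * 3 ^ boxSize ω m.box ≤ 3 ^ boxSize ω n.box := fun m hm => by
        rw [hA, Finset.mem_filter, Finset.mem_image] at hm
        obtain ⟨⟨i, -, rfl⟩, -⟩ := hm
        rw [← pow_succ', hkid]
        exact Nat.pow_le_pow_right (by norm_num) (boxSize_child_lt hω hne hj h0 i)
      have hcard : A.card ≤ 2 :=
        (Finset.card_filter_le _ _).trans (Finset.card_image_le.trans (by simp))
      have h1 := Finset.sum_le_card_nsmul A _ _ hle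
      rw [← Finset.mul_sum, smul_eq_mul] at h1
      have h2 := Nat.mul_le_mul_right (3 ^ boxSize ω n.box) hcard
      have h3 : 0 < 3 ^ boxSize ω n.box := by positivity
      omega
  unfold potential
  rw [hnodes]
  -- A child may coincide with a node already present, so the union need not be disjoint; overlap
  -- only lowers the sum.
  have h1 := Finset.sum_union_inter (s₁ := A) (s₂ := S.nodes.erase n)
    (f := fun m => 3 ^ boxSize ω m.box)
  have h2 := Finset.sum_erase_add S.nodes (fun m => 3 ^ boxSize ω m.box) hn
  omega

lemma not_forall_step {rule : AngleRule}
    (hrule : rule = AngleRule.endpoint → LinearIndependent ℂ N.h) {ε η : ℝ} (hε : 0 < ε)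
    (hη : 0 < η) {σ : ℕ → State M K} (h0 : IsInit N η (σ 0)) :
    ¬ ∀ n, Step N rule ε η (σ n) (σ (n + 1)) := by
  intro hstep
  obtain ⟨ω, hω, hsmall⟩ := exists_small_box_size N rule hrule hε
  obtain ⟨D, hD⟩ := exists_objective_le N
  have hvalid : ∀ n, (σ n).Valid N ε η := fun n => by
    induction n with
    | zero => exact h0.valid hε hη
    | succ n ih => exact (hstep n).valid hε hη ih
  -- This bounds the number of improvements still possible, as `δ ≤ D + η` once an incumbent is set.
  let m : ℕ → ℕ := fun n => ⌊(D + η - (σ n).δ) / η⌋₊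
  have hm : ∀ n, m (n + 1) ≤ m n := fun n => Nat.floor_mono (by
    have := (hstep n).δ_le hη
    gcongr)
  obtain ⟨n, hn⟩ := WellFounded.not_rel_apply_succ (r := ((· < ·) : ℕ ×ₗ ℕ → ℕ ×ₗ ℕ → Prop))
    fun n => toLex (m n, potential ω (σ n))
  refine hn (Prod.Lex.toLex_lt_toLex.2 ?_)
  rcases (hstep n).potential_lt hω hη hsmall (hvalid n) with h | ⟨h, x, hx, h'⟩
  · rcases (hm n).lt_or_eq with h1 | h1
    · exact .inl h1
    · exact .inr ⟨h1, h⟩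
  · left
    -- Nonnegativity is needed because `⌊·⌋₊` truncates at zero; otherwise the drop by one could be
    -- lost.
    have h1 : 0 ≤ (D + η - (σ (n + 1)).δ) / η :=
      div_nonneg (by rw [h']; linarith [hD x hx]) hη.le
    have h2 : (D + η - (σ (n + 1)).δ) / η + 1 ≤ (D + η - (σ n).δ) / η := by
      rw [div_add_one hη.ne']
      gcongr
      linarith
    have h3 := Nat.floor_mono h2
    rw [Nat.floor_add_one h1] at h3
    exact h3

end Run

end RSMA

/-- Every run of the algorithm is finite, it never gets stuck while boxes remain, and when no box
remains its report is correct. The angles of the dual feasible points are the arguments of `e_k`, or,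
for linearly independent channels, the closest end points of the angle intervals. -/
theorem theorem1 {M K : ℕ} [NeZero K] (N : RSMA.Network M K) (rule : RSMA.AngleRule)
    (hrule : rule = RSMA.AngleRule.endpoint → LinearIndependent ℂ N.h)
    (ε η : ℝ) (hε : 0 < ε) (hη : 0 < η) :
    (∀ σ : ℕ → RSMA.State M K, RSMA.IsInit N η (σ 0) →
      ¬ ∀ n, RSMA.Step N rule ε η (σ n) (σ (n + 1))) ∧
    ∀ S : RSMA.State M K, RSMA.Reachable N rule ε η S →
      (S.nodes.Nonempty → ∃ S', RSMA.Step N rule ε η S S') ∧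
      (S.nodes = ∅ → RSMA.Correct N ε η S) :=
  ⟨fun _ h0 => RSMA.not_forall_step hrule hε hη h0, fun _ hS =>
    ⟨(hS.valid hε hη).exists_step rule, fun h => (hS.valid hε hη).correct h hε⟩⟩
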